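/- Let $q\in\mathbb C$ with $0<|q|<1$. For $u\in\mathbb C$ and $n\in\mathbb N_0$ put $(u;q)_n=\prod_{j=0}^{n-1}(1-uq^j)$, $(u;q)_\infty=\prod_{j\ge 0}(1-uq^j)$, $(u_1,\dots,u_r;q)_n=\prod_i (u_i;q)_n$ (also for $n=\infty$), and write $z^{\pm}$ for the pair $z,z^{-1}$. Let $${}_4\phi_3\!\left(\begin{matrix}u_1,u_2,u_3,u_4\\ v_1,v_2,v_3\end{matrix};q,q\right)=\sum_{k\ge 0}\frac{(u_1,u_2,u_3,u_4;q)_k}{(q,v_1,v_2,v_3;q)_k}\,q^k ,$$ where, if $u_1=q^{-n}$ with $n\in\mathbb N_0$, the sum runs over $0\le k\le n$. For $x=\frac12(z+z^{-1})$ let $$p_n(x;a,b,c,d|q)=a^{-n}(ab,ac,ad;q)_n\;{}_4\phi_3\!\left(\begin{matrix}q^{-n},q^{n-1}abcd,az,az^{-1}\\ ab,ac,ad\end{matrix};q,q\right)$$ be the Askey--Wilson polynomial; when $ab$, $ac$ or $ad$ makes a denominator vanish, $p_n$ is defined by multiplying $(ab,ac,ad;q)_n$ into the terminating sum. **Theorem.**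 Let $n\in\mathbb N_0$, let $z,a,b,c,d,e,f\in\mathbb C\setminus\{0\}$ with $\max\{|cz|,|c/z|\}<1$, and let $x=\frac12(z+z^{-1})$. Assume that none of $ac$, $bc$, $cf$, $ae$, $be$, $ef$, $abcf$, $abef/q$, $ez$, $e/z$ lies in $\{q^{-j}:j\in\mathbb N_0\}$. (i) If $(cd;q)_n\ne 0$ and $(q^{1-k}c/e;q)_n\neq 0$ for all $k\in\mathbb N_0$, then $$p_{n}(x;a,b,c,d|q)=\frac{(ae,be,ef,abcf,cz^\pm;q)_\infty}{(ac,bc,cf,abef,ez^\pm;q)_\infty}(ac,bc,cd;q)_{n}\sum_{k=0}^\infty c^{k-n}\frac{(abef;q)_{2k}(\frac{e}{c},\frac{abef}{q};q)_k}{(\frac{abef}{q};q)_{2k}(q,ae,be,ef,abcf;q)_k}\,p_k(x;a,b,e,f|q)\;{}_4\phi_3\!\left(\begin{matrix}q^{-n},q^{n-1}abcd,cf,\frac{qc}{e}\\ cd,q^kabcf,q^{1-k}\frac{c}{e}\end{matrix};q,q\right).$$ (ii) If neither $ab$ nor $q^{1-n}f/d$ lies in $\{q^{-j}:j\in\mathbb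 N_0\}$, then $$p_{n}(x;a,b,c,d|q)=\frac{(ae,be,ef,abcf,cz^\pm;q)_\infty}{(ac,bc,cf,abef,ez^\pm;q)_\infty}\,\frac{(ab,ac,bc,\frac{d}{f};q)_{n}}{(abcf;q)_n}\sum_{k=0}^\infty f^{n-k}\frac{(abef;q)_{2k}(\frac{abef}{q};q)_k}{(\frac{abef}{q};q)_{2k}(q,ab,ae,be;q)_k}\,p_k(x;a,b,e,f|q)\;{}_4\phi_3\!\left(\begin{matrix}q^{-k},q^{k-1}abef,cf,\frac{qf}{d}\\ ef,q^nabcf,q^{1-n}\frac{f}{d}\end{matrix};q,q\right).$$ Both infinite series converge absolutely. -/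

import Mathlib

open Finset

/-- The finite `q`-shifted factorial `(a;q)_n = (1 - a)(1 - aq) ⋯ (1 - aq^{n-1})`. -/
def qPoch (a q : ℂ) (n : ℕ) : ℂ := ∏ j ∈ range n, (1 - a * q ^ j)

/-- The infinite `q`-shifted factorial `(a;q)_∞ = ∏_{j ≥ 0} (1 - aq^j)`, for `|q| < 1`. -/
noncomputable def qPochInf (a q : ℂ) : ℂ := ∏' j : ℕ, (1 - a * q ^ j)

/-- The product `(a₁, …, a_r; q)_n = (a₁;q)_n ⋯ (a_r;q)_n`. -/
def qPochs (as : List ℂ) (q : ℂ) (n : ℕ) : ℂ := (as.map fun a => qPoch a q n).prod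

/-- The product `(a₁, …, a_r; q)_∞ = (a₁;q)_∞ ⋯ (a_r;q)_∞`. -/
noncomputable def qPochsInf (as : List ℂ) (q : ℂ) : ℂ := (as.map fun a => qPochInf a q).prod

/-- The basic hypergeometric series `_rφ_s(a₁, …, a_r; b₁, …, b_s; q, w)`. If some `aᵢ` equals
`q^{-n}`, the terms with index `k > n` vanish and the series is a finite sum. -/
noncomputable def basicHyp (as bs : List ℂ) (q w : ℂ) : ℂ :=
  ∑' k : ℕ, qPochs as q k / qPochs (q :: bs) q k
    * ((-1) ^ k * q ^ (k.choose 2)) ^ (1 + (bs.length : ℤ) - (as.length : ℤ)) * w ^ k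

/-- The Askey--Wilson polynomial `p_n(x; a, b, c, d | q)`, for `a ≠ 0`. It is
`a^{-n} (ab, ac, ad; q)_n` times the terminating series
`_4φ_3(q^{-n}, q^{n-1}abcd, az, a/z; ab, ac, ad; q, q)`, where `x = (z + 1/z)/2`
(see `askeyWilson_eq`), with the factor `(ab, ac, ad; q)_n` multiplied into the sum, so that no
condition on `ab, ac, ad` is needed, and with `(az, a/z; q)_k` written as the polynomial
`∏_{j < k} (1 - 2axq^j + a²q^{2j})` in `x`. -/
noncomputable def askeyWilson (n : ℕ) (x a b c d q : ℂ) : ℂ :=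
  (a ^ n)⁻¹ * ∑ k ∈ range (n + 1),
    qPochs [q ^ (-(n : ℤ)), q ^ ((n : ℤ) - 1) * (a * b * c * d)] q k / qPoch q q k
      * (∏ j ∈ range k, (1 - 2 * a * x * q ^ j + a ^ 2 * q ^ (2 * j)))
      * qPochs [a * b * q ^ k, a * c * q ^ k, a * d * q ^ k] q (n - k)
      * q ^ k

theorem qPoch_split (a q : ℂ) {k n : ℕ} (h : k ≤ n) :
    qPoch a q n = qPoch a q k * qPoch (a * q ^ k) q (n - k) := by
  obtain ⟨m, rfl⟩ := Nat.exists_eq_add_of_le h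
  simp only [qPoch, prod_range_add, Nat.add_sub_cancel_left]
  congr 1
  refine prod_congr rfl fun j _ => ?_
  ring

theorem qPoch_ne_zero {a q : ℂ} {k n : ℕ} (h : ∀ j < n, a * q ^ j ≠ 1) (hk : k ≤ n) :
    qPoch a q k ≠ 0 := by
  refine prod_ne_zero_iff.2 fun j hj => sub_ne_zero.2 (h j ?_).symm
  exact (mem_range.1 hj).trans_le hk

theorem qPoch_neg_pow_eq_zero {q : ℂ} (hq : q ≠ 0) {n k : ℕ} (h : n < k) :
    qPoch (q ^ (-(n : ℤ))) q k = 0 := by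
  refine prod_eq_zero (mem_range.2 h) ?_
  rw [← zpow_natCast q n, ← zpow_add₀ hq]
  simp

/-- The partial products of `(a;q)_∞` converge to it. -/
theorem tendsto_qPoch_qPochInf (a : ℂ) {q : ℂ} (hq : ‖q‖ < 1) :
    Filter.Tendsto (fun n => qPoch a q n) Filter.atTop (nhds (qPochInf a q)) := by
  have hs : Summable fun j : ℕ => ‖-(a * q ^ j)‖ := by
    simpa [norm_mul, norm_pow] using
      (summable_geometric_of_lt_one (norm_nonneg q) hq).mul_left ‖a‖
  have := (multipliable_one_add_of_summable hs).tendsto_prod_tprod_nat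
  simpa only [← sub_eq_add_neg, qPoch, qPochInf] using this

/-- The hypergeometric formula for the Askey--Wilson polynomials. -/
theorem askeyWilson_eq (n : ℕ) {z a b c d q : ℂ} (hq : q ≠ 0) (hz : z ≠ 0)
    (hab : ∀ j < n, a * b * q ^ j ≠ 1) (hac : ∀ j < n, a * c * q ^ j ≠ 1)
    (had : ∀ j < n, a * d * q ^ j ≠ 1) :
    askeyWilson n ((z + z⁻¹) / 2) a b c d q =
      (a ^ n)⁻¹ * qPochs [a * b, a * c, a * d] q n *
        basicHyp [q ^ (-(n : ℤ)), q ^ ((n : ℤ) - 1) * (a * b * c * d), a * z, a / z]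
          [a * b, a * c, a * d] q q := by
  have hfin : ∀ k ∉ range (n + 1),
      qPochs [q ^ (-(n : ℤ)), q ^ ((n : ℤ) - 1) * (a * b * c * d), a * z, a / z] q k
        / qPochs [q, a * b, a * c, a * d] q k
        * ((-1) ^ k * q ^ (k.choose 2)) ^ (1 + (([a * b, a * c, a * d] : List ℂ).length : ℤ)
          - (([q ^ (-(n : ℤ)), q ^ ((n : ℤ) - 1) * (a * b * c * d), a * z, a / z] :
            List ℂ).length : ℤ)) * q ^ k = 0 := by
    intro k hk
    have : n < k := by simpa [Nat.lt_succ_iff] using hk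
    simp only [qPochs, List.map_cons, List.prod_cons, qPoch_neg_pow_eq_zero hq this, zero_mul,
      zero_div]
  rw [askeyWilson, basicHyp, tsum_eq_sum hfin, mul_assoc (a ^ n)⁻¹]
  congr 1
  rw [mul_sum]
  refine sum_congr rfl fun k hk => ?_
  have hk' : k ≤ n := Nat.lt_succ_iff.1 (mem_range.1 hk)
  have hzz : ∏ j ∈ range k, (1 - 2 * a * ((z + z⁻¹) / 2) * q ^ j + a ^ 2 * q ^ (2 * j))
      = qPoch (a * z) q k * qPoch (a / z) q k := by
    rw [qPoch, qPoch, ← prod_mul_distrib]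
    refine prod_congr rfl fun j _ => ?_
    field_simp
    ring
  have h1 := qPoch_ne_zero hab hk'
  have h2 := qPoch_ne_zero hac hk'
  have h3 := qPoch_ne_zero had hk'
  rw [hzz]
  simp only [qPochs, List.map_cons, List.map_nil, List.prod_cons, List.prod_nil, mul_one,
    List.length_cons, List.length_nil]
  rw [qPoch_split (a * b) q hk', qPoch_split (a * c) q hk', qPoch_split (a * d) q hk']
  norm_num
  by_cases h4 : qPoch q q k = 0
  · simp [h4]
  · field_simp

/-! By symmetry in the parameters, p_n(x;a,b,c,d) can be written with c as the distinguished one, so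
that x enters only through (cz, c/z;q)_j with 0 ≤ j ≤ n. Since (cz, c/z;q)_j = (cz, c/z;q)_∞ / (cq^j
z, cq^j/z;q)_∞, it suffices to expand (ez, e/z;q)_∞ / (cz, c/z;q)_∞ in the p_k(x;a,b,e,f), apply
this with cq^j in place of c, and exchange the finite j-sum with the series. The coefficient of p_k
is then a finite sum over j, `connectionCoeff`.

The expansion of the quotient (`hasSum_expansionWeight_mul_askeyWilson`) comes from analytic
continuation in c. At c = eq^m the quotient is (ez, e/z;q)_m and the series terminates; that case is
the inversion of the defining sum of p_k (`sum_expansionWeight_mul_askeyWilson`). After clearing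
denominators both sides are analytic in c on a disc about 0, and the points eq^m accumulate at 0.
Uniform convergence there needs p_k = O((k+1) max(|z|,|1/z|)^k), read off from
`askeyWilson_eq_convolution`, which also gives the symmetry in the parameters.

The two formulas are two evaluations of the same coefficient. Rewriting each term gives the _4φ_3 of
(i) (`connectionCoeff_eq_basicHyp`). Expanding the k-dependent factor by a balanced _3φ_2 sum,
exchanging sums and summing over j by the same formula gives the _4φ_3 of (ii)
(`connectionCoeff_eq_basicHyp'`). The only summation theorem used besides the inversion is
q-Saalschütz, kept free of denominators so that no genericity assumptions arise. -/

/-! ### Elementary identities for shifted factorials. -/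

theorem qPoch_zero (a q : ℂ) : qPoch a q 0 = 1 := by simp [qPoch]

theorem qPoch_succ (a q : ℂ) (n : ℕ) : qPoch a q (n + 1) = qPoch a q n * (1 - a * q ^ n) := by
  simp [qPoch, prod_range_succ]

theorem qPoch_add (a q : ℂ) (m n : ℕ) :
    qPoch a q (m + n) = qPoch a q m * qPoch (a * q ^ m) q n := by
  simpa using qPoch_split a q (Nat.le_add_right m n)

theorem qPoch_succ' (a q : ℂ) (n : ℕ) : qPoch a q (n + 1) = (1 - a) * qPoch (a * q) q n := by
  rw [add_comm, qPoch_add]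
  simp [qPoch]

theorem pow_succ_ne_one {q : ℂ} (hq1 : ‖q‖ < 1) (j : ℕ) : q ^ (j + 1) ≠ 1 := by
  intro h
  have := congrArg norm h
  rw [norm_pow, norm_one] at this
  exact (pow_lt_one₀ (norm_nonneg q) hq1 (Nat.succ_ne_zero j)).ne this

theorem qPoch_self_ne_zero {q : ℂ} (hq1 : ‖q‖ < 1) (n : ℕ) : qPoch q q n ≠ 0 :=
  qPoch_ne_zero (n := n) (fun j _ => by
    rw [← pow_succ']; exact pow_succ_ne_one hq1 j) le_rfl

/-- Inversion of the base point of a shifted factorial. -/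
theorem prod_mul_qPoch_inv {q w : ℂ} (hq : q ≠ 0) (hw : w ≠ 0) (N : ℤ) (m : ℕ) :
    (∏ i ∈ range m, (-(w * q ^ (N - 1 - i)))) * qPoch (q ^ (1 - N) / w) q m
      = qPoch (w * q ^ (N - m)) q m := by
  rw [qPoch, qPoch, ← prod_mul_distrib,
    ← prod_range_reflect (fun j => 1 - w * q ^ (N - m) * q ^ j)]
  refine prod_congr rfl fun i hi => ?_
  have hi' := mem_range.1 hi
  have e1 : w * q ^ (N - m) * q ^ (m - 1 - i) = w * q ^ (N - 1 - i) := by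
    rw [mul_assoc, ← zpow_natCast q, ← zpow_add₀ hq]
    congr 2
    have : ((m - 1 - i : ℕ) : ℤ) = m - 1 - i := by omega
    rw [this]; ring
  have e2 : w * q ^ (N - 1 - i) * (q ^ (1 - N) / w * q ^ i) = 1 := by
    have : q ^ (N - 1 - i) * (q ^ (1 - N) * q ^ i) = 1 := by
      rw [← zpow_natCast q, ← zpow_add₀ hq, ← zpow_add₀ hq]
      ring_nf; simp
    field_simp
    linear_combination this
  rw [e1]
  linear_combination e2

/-! ### The q-Saalschütz sum and the terminating balanced _3φ_2. -/

/-- The summand of the polynomial form of the `q`-Saalschütz sum, up to `(q;q)_{i+l}`. -/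
noncomputable def saalTerm (u v G q : ℂ) (i l : ℕ) : ℂ :=
  G ^ i * qPoch u q i * qPoch v q i * qPoch G q l * qPoch (u * v * G * q ^ i) q l
    / (qPoch q q i * qPoch q q l)

/-- The telescoping certificate for `saalTerm`. -/
noncomputable def saalCert (u v G q : ℂ) (i l : ℕ) : ℂ :=
  -(q ^ l * (1 - q ^ i) * (G ^ i * qPoch u q i * qPoch v q i * qPoch G q l
    * qPoch (u * v * G / q * q ^ i) q l) / (qPoch q q i * qPoch q q l))

/-- A WZ-type certificate: on the line i + m = k the right side is a difference in i, so summation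
over i yields a first-order recurrence in k. After removal of the common factors it is a rational
identity in q^i and q^m. -/
theorem saalTerm_telescope {q : ℂ} (hq : q ≠ 0) (hq1 : ‖q‖ < 1) (u v G : ℂ) (i m : ℕ) :
    (1 - q ^ (i + m + 1)) * saalTerm u v G q i (m + 1)
      - (1 - u * G * q ^ (i + m)) * (1 - v * G * q ^ (i + m)) * saalTerm u v G q i m
      = saalCert u v G q (i + 1) m - saalCert u v G q i (m + 1) := by
  have h1 := qPoch_self_ne_zero hq1 i
  have h2 := qPoch_self_ne_zero hq1 m
  have h3 : 1 - q * q ^ i ≠ 0 := by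
    rw [← pow_succ']; exact sub_ne_zero.2 (pow_succ_ne_one hq1 i).symm
  have h4 : 1 - q * q ^ m ≠ 0 := by
    rw [← pow_succ']; exact sub_ne_zero.2 (pow_succ_ne_one hq1 m).symm
  have e1 : u * v * G / q * q ^ (i + 1) = u * v * G * q ^ i := by
    field_simp
    ring
  have e2 : qPoch (u * v * G / q * q ^ i) q (m + 1)
      = (1 - u * v * G / q * q ^ i) * qPoch (u * v * G * q ^ i) q m := by
    rw [qPoch_succ']
    congr 2
    field_simp
  simp only [saalTerm, saalCert]
  rw [e1, e2]
  simp only [qPoch_succ, pow_succ, pow_add]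
  generalize qPoch (u * v * G * q ^ i) q m = A
  generalize qPoch q q i = B at *
  generalize qPoch q q m = C at *
  generalize q ^ i = x at *
  generalize q ^ m = y at *
  have h3' : 1 - x * q ≠ 0 := by rwa [mul_comm]
  have h4' : 1 - y * q ≠ 0 := by rwa [mul_comm]
  field_simp
  ring

/-- The `q`-Saalschütz sum, in a form without denominators. -/
theorem qPoch_mul_qPoch_eq_sum {q : ℂ} (hq : q ≠ 0) (hq1 : ‖q‖ < 1) (u v G : ℂ) (k : ℕ) :
    qPoch (u * G) q k * qPoch (v * G) q k
      = ∑ j ∈ range (k + 1), qPoch q q k / (qPoch q q j * qPoch q q (k - j))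
          * (G ^ j * qPoch u q j * qPoch v q j * qPoch G q (k - j)
            * qPoch (u * v * G * q ^ j) q (k - j)) := by
  have key : ∀ k, qPoch (u * G) q k * qPoch (v * G) q k
      = qPoch q q k * ∑ j ∈ range (k + 1), saalTerm u v G q j (k - j) := by
    intro k
    induction k with
    | zero => simp [saalTerm, qPoch_zero]
    | succ k ih =>
      -- Summing the certificate along i + l = k + 1. It vanishes at i = 0, because of its factor 1
      -- - q^i.
      have tel : ∀ m ≤ k + 1, ∑ i ∈ range m, ((1 - q ^ (k + 1)) * saalTerm u v G q i (k + 1 - i)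
          - (1 - u * G * q ^ k) * (1 - v * G * q ^ k) * saalTerm u v G q i (k - i))
          = saalCert u v G q m (k + 1 - m) := by
        intro m
        induction m with
        | zero => intro _; simp [saalCert]
        | succ m ihm =>
          intro hm
          rw [sum_range_succ, ihm (by omega)]
          obtain ⟨l, rfl⟩ := Nat.exists_eq_add_of_le (show m ≤ k by omega)
          have := saalTerm_telescope hq hq1 u v G m l
          rw [show m + l + 1 - m = l + 1 by omega, show m + l - m = l by omega,
            show m + l + 1 - (m + 1) = l by omega]
          linear_combination this
      have h := tel (k + 1) le_rfl
      -- The telescoped sum stops at i = k; the boundary value is minus the missing term i = k + 1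
      -- of the longer sum.
      have hlast : saalCert u v G q (k + 1) (k + 1 - (k + 1))
          = -((1 - q ^ (k + 1)) * saalTerm u v G q (k + 1) (k + 1 - (k + 1))) := by
        simp only [saalCert, saalTerm, Nat.sub_self, qPoch_zero, pow_zero]
        ring
      rw [hlast, sum_sub_distrib, ← mul_sum, ← mul_sum] at h
      rw [sum_range_succ, qPoch_succ, qPoch_succ, qPoch_succ q q]
      have h' : q * q ^ k = q ^ (k + 1) := by ring
      rw [h']
      linear_combination (1 - u * G * q ^ k) * (1 - v * G * q ^ k) * ih - qPoch q q k * h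
  rw [key k, mul_sum]
  refine sum_congr rfl fun j _ => ?_
  rw [saalTerm]
  ring

/-- Each factor is 1 - q^{-n+i} = -q^{-n+i}(1 - q^{n-i}). This passes between q-binomial
coefficients and the numerator parameter q^{-n}. -/
theorem qPoch_ratio {q : ℂ} (hq : q ≠ 0) (hq1 : ‖q‖ < 1) {j n : ℕ} (hj : j ≤ n) :
    qPoch (q ^ (-(n : ℤ))) q j
      = (∏ i ∈ range j, (-(q ^ (-(n : ℤ) + i)))) * (qPoch q q n / qPoch q q (n - j)) := by
  induction j with
  | zero => simp [qPoch_zero, qPoch_self_ne_zero hq1]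
  | succ j ih =>
    rw [qPoch_succ, ih (by omega), prod_range_succ]
    obtain ⟨l, rfl⟩ := Nat.exists_eq_add_of_le hj
    rw [show j + 1 + l - j = l + 1 by omega, show j + 1 + l - (j + 1) = l by omega, qPoch_succ q q l]
    have h2 := qPoch_self_ne_zero hq1 l
    have h4 : 1 - q * q ^ l ≠ 0 := by
      rw [← pow_succ']; exact sub_ne_zero.2 (pow_succ_ne_one hq1 l).symm
    have e : q ^ (-((j + 1 + l : ℕ) : ℤ) + j) * (q * q ^ l) = 1 := by
      rw [← pow_succ', ← zpow_natCast q, ← zpow_add₀ hq]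
      push_cast; ring_nf; simp
    rw [← zpow_natCast q j, ← zpow_add₀ hq]
    field_simp
    linear_combination (-(∏ i ∈ range j, (-(q ^ (-((j + 1 + l : ℕ) : ℤ) + i)))) * qPoch q q (j + 1 + l)) * e

/-- The terminating balanced `_3φ_2` sum, without denominators. -/
theorem sum_balanced {q : ℂ} (hq : q ≠ 0) (hq1 : ‖q‖ < 1) {X Y E F : ℂ} (hX : X ≠ 0) (hE : E ≠ 0)
    (N : ℕ) (h : X * Y = E * F * q ^ ((N : ℤ) - 1)) :
    ∑ m ∈ range (N + 1), qPoch (q ^ (-(N : ℤ))) q m / qPoch q q m * q ^ m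
        * (qPoch X q m * qPoch Y q m) * (qPoch (E * q ^ m) q (N - m) * qPoch (F * q ^ m) q (N - m))
      = X ^ N * (qPoch (E / X) q N * qPoch (F / X) q N) := by
  -- With G = q^{1-N}/E the balancing condition turns uvG into F and vG into F/X; the factorials
  -- based at G and XG become those of E and E/X by reversing the order of their factors.
  have H := qPoch_mul_qPoch_eq_sum hq hq1 X Y (q ^ (1 - (N : ℤ)) / E) N
  have hP : q ^ ((N : ℤ) - 1) * q ^ (1 - (N : ℤ)) = 1 := by
    rw [← zpow_add₀ hq]; simp
  have e1 : X * Y * (q ^ (1 - (N : ℤ)) / E) = F := by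
    rw [h]; field_simp; linear_combination F * hP
  have e2 : Y * (q ^ (1 - (N : ℤ)) / E) = F / X := by
    rw [← e1]; field_simp
  rw [e1, e2] at H
  have e3 : (∏ i ∈ range N, (-(E * q ^ ((N : ℤ) - 1 - i))))
      * qPoch (X * (q ^ (1 - (N : ℤ)) / E)) q N = X ^ N * qPoch (E / X) q N := by
    have := prod_mul_qPoch_inv hq (w := E / X) (div_ne_zero hE hX) N N
    rw [sub_self, zpow_zero, mul_one] at this
    rw [← this, show X * (q ^ (1 - (N : ℤ)) / E) = q ^ (1 - (N : ℤ)) / (E / X) by field_simp,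
      ← mul_assoc]
    congr 1
    rw [← card_range N, ← prod_const, card_range, ← prod_mul_distrib]
    refine prod_congr rfl fun i _ => ?_
    field_simp
  have H2 := congrArg (fun t => (∏ i ∈ range N, (-(E * q ^ ((N : ℤ) - 1 - i)))) * t) H
  beta_reduce at H2
  rw [← mul_assoc, e3, mul_sum] at H2
  rw [← mul_assoc, H2]
  refine sum_congr rfl fun j hj => ?_
  have hj' : j ≤ N := Nat.lt_succ_iff.1 (mem_range.1 hj)
  -- Of the N reversing factors, N - j turn (G;q)_{N-j} into (Eq^j;q)_{N-j}; the other j combine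
  -- with G^j into the sign and power of q contained in (q^{-N};q)_j.
  have e4 := prod_mul_qPoch_inv hq hE N (N - j)
  have e5 : (N : ℤ) - ((N - j : ℕ) : ℤ) = j := by omega
  rw [e5, zpow_natCast] at e4
  have e6 : (∏ i ∈ range N, (-(E * q ^ ((N : ℤ) - 1 - i))))
      = (∏ i ∈ range (N - j), (-(E * q ^ ((N : ℤ) - 1 - i))))
        * ∏ i ∈ range j, (-(E * q ^ (i : ℤ))) := by
    obtain ⟨l, rfl⟩ := Nat.exists_eq_add_of_le hj'
    rw [show j + l - j = l by omega, show j + l = l + j by omega, prod_range_add]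
    congr 1
    rw [← prod_range_reflect]
    refine prod_congr rfl fun i hi => ?_
    have := mem_range.1 hi
    congr 3
    omega
  have e7 : (∏ i ∈ range j, (-(E * q ^ (i : ℤ)))) * (q ^ (1 - (N : ℤ)) / E) ^ j
      = (∏ i ∈ range j, (-(q ^ (-(N : ℤ) + i)))) * q ^ j := by
    rw [← card_range j, ← prod_const, ← prod_const, card_range, ← prod_mul_distrib,
      ← prod_mul_distrib]
    refine prod_congr rfl fun i _ => ?_
    rw [neg_mul, neg_mul, show q ^ (-(N : ℤ) + i) * q = q ^ (1 - (N : ℤ)) * q ^ (i : ℤ) by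
      rw [← zpow_add_one₀ hq, ← zpow_add₀ hq]; ring_nf]
    field_simp
  rw [qPoch_ratio hq hq1 hj', e6, ← e4]
  have h1 := qPoch_self_ne_zero hq1 j
  have h2 := qPoch_self_ne_zero hq1 (N - j)
  linear_combination (-((∏ i ∈ range (N - j), (-(E * q ^ ((N : ℤ) - 1 - i))))
    * (qPoch q q N / (qPoch q q j * qPoch q q (N - j))) * qPoch X q j * qPoch Y q j
    * qPoch (q ^ (1 - (N : ℤ)) / E) q (N - j) * qPoch (F * q ^ j) q (N - j))) * e7

/-! ### Convolution form and symmetry of the Askey–Wilson polynomials. -/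

theorem askeyWilson_eq_sum (n : ℕ) {z : ℂ} (a b c d q : ℂ) (hz : z ≠ 0) :
    askeyWilson n ((z + z⁻¹) / 2) a b c d q = (a ^ n)⁻¹ * ∑ k ∈ range (n + 1),
      qPoch (q ^ (-(n : ℤ))) q k / qPoch q q k * q ^ k
        * qPoch (q ^ ((n : ℤ) - 1) * (a * b * c * d)) q k * (qPoch (a * z) q k * qPoch (a / z) q k)
        * (qPoch (a * b * q ^ k) q (n - k) * qPoch (a * c * q ^ k) q (n - k)
          * qPoch (a * d * q ^ k) q (n - k)) := by
  rw [askeyWilson]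
  congr 1
  refine sum_congr rfl fun k _ => ?_
  have hzz : ∏ j ∈ range k, (1 - 2 * a * ((z + z⁻¹) / 2) * q ^ j + a ^ 2 * q ^ (2 * j))
      = qPoch (a * z) q k * qPoch (a / z) q k := by
    rw [qPoch, qPoch, ← prod_mul_distrib]
    refine prod_congr rfl fun j _ => ?_
    field_simp
    ring
  rw [hzz]
  simp only [qPochs, List.map_cons, List.map_nil, List.prod_cons, List.prod_nil, mul_one]
  ring

theorem sum_range_triangle {M : Type*} [AddCommMonoid M] (n : ℕ) (f : ℕ → ℕ → M) :
    ∑ k ∈ range (n + 1), ∑ j ∈ range (k + 1), f k j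
      = ∑ j ∈ range (n + 1), ∑ m ∈ range (n - j + 1), f (j + m) j := by
  rw [sum_comm' (s' := fun j => Ico j (n + 1)) (t' := range (n + 1))]
  · refine sum_congr rfl fun j hj => ?_
    rw [sum_Ico_eq_sum_range]
    have := mem_range.1 hj
    rw [show n + 1 - j = n - j + 1 by omega]
  · intro k j
    simp only [mem_range, mem_Ico]
    omega

/-- A representation of the Askey--Wilson polynomial as a sum of `n + 1` terms that
stay bounded up to powers of `z` and `z⁻¹`. -/
theorem askeyWilson_eq_convolution (n : ℕ) {z a b c d q : ℂ} (hq : q ≠ 0) (hq1 : ‖q‖ < 1)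
    (hz : z ≠ 0) (ha : a ≠ 0) (hc : c ≠ 0) (hd : d ≠ 0) :
    askeyWilson n ((z + z⁻¹) / 2) a b c d q = ∑ j ∈ range (n + 1),
      qPoch q q n / (qPoch q q j * qPoch q q (n - j)) * (z ^ (n - j) * (z⁻¹) ^ j)
        * (qPoch (a * z) q j * qPoch (b * z) q j)
        * (qPoch (c / z) q (n - j) * qPoch (d / z) q (n - j))
        * (qPoch (a * b * q ^ j) q (n - j) * qPoch (c * d * q ^ (n - j)) q j) := by
  rw [askeyWilson_eq_sum n a b c d q hz]
  -- Chosen, together with u = bz, so that uG = q^{n-1}abcd, vG = a/z and uvG = ab: q-Saalschütz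
  -- then splits the product (q^{n-1}abcd, a/z;q)_k.
  set v : ℂ := q ^ (1 - (n : ℤ)) / (c * d) with hv
  set G : ℂ := q ^ ((n : ℤ) - 1) * (a * c * d) / z with hG
  have hP : q ^ ((n : ℤ) - 1) * q ^ (1 - (n : ℤ)) = 1 := by
    rw [← zpow_add₀ hq]; simp
  have hvG : v * G = a / z := by
    rw [hv, hG]; field_simp; linear_combination hP
  have huG : b * z * G = q ^ ((n : ℤ) - 1) * (a * b * c * d) := by
    rw [hG]; field_simp
  have hD : b * z * v * G = a * b := by
    rw [mul_assoc, hvG]; field_simp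
  have step1 : ∀ k ∈ range (n + 1),
      qPoch (q ^ (-(n : ℤ))) q k / qPoch q q k * q ^ k
        * qPoch (q ^ ((n : ℤ) - 1) * (a * b * c * d)) q k * (qPoch (a * z) q k * qPoch (a / z) q k)
        * (qPoch (a * b * q ^ k) q (n - k) * qPoch (a * c * q ^ k) q (n - k)
          * qPoch (a * d * q ^ k) q (n - k))
      = ∑ j ∈ range (k + 1), qPoch (q ^ (-(n : ℤ))) q k * q ^ k * qPoch (a * z) q k
        * (qPoch (a * b * q ^ k) q (n - k) * qPoch (a * c * q ^ k) q (n - k)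
          * qPoch (a * d * q ^ k) q (n - k)) * (1 / (qPoch q q j * qPoch q q (k - j))
          * (G ^ j * qPoch (b * z) q j * qPoch v q j * qPoch G q (k - j)
            * qPoch (a * b * q ^ j) q (k - j))) := by
    intro k _
    have h := qPoch_mul_qPoch_eq_sum hq hq1 (b * z) v G k
    rw [huG, hvG, hD] at h
    have cancel : ∀ D t : ℂ, 1 / qPoch q q k * (qPoch q q k / D * t) = 1 / D * t := by
      intro D t
      calc _ = (qPoch q q k / qPoch q q k) * (1 / D * t) := by ring
        _ = _ := by rw [div_self (qPoch_self_ne_zero hq1 k), one_mul]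
    calc _ = qPoch (q ^ (-(n : ℤ))) q k * q ^ k * qPoch (a * z) q k
        * (qPoch (a * b * q ^ k) q (n - k) * qPoch (a * c * q ^ k) q (n - k)
          * qPoch (a * d * q ^ k) q (n - k)) * (1 / qPoch q q k
          * (qPoch (q ^ ((n : ℤ) - 1) * (a * b * c * d)) q k * qPoch (a / z) q k)) := by ring
      _ = _ := by
        rw [h, mul_sum, mul_sum]
        refine sum_congr rfl fun j _ => ?_
        rw [cancel]
  rw [sum_congr rfl step1, sum_range_triangle, mul_sum]
  refine sum_congr rfl fun j hj => ?_
  have hj' : j ≤ n := Nat.lt_succ_iff.1 (mem_range.1 hj)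
  obtain ⟨N, rfl⟩ := Nat.exists_eq_add_of_le hj'
  rw [show j + N - j = N by omega]
  have hbal : a * z * q ^ j * G = a * c * q ^ j * (a * d * q ^ j) * q ^ ((N : ℤ) - 1) := by
    have : q ^ (((j + N : ℕ) : ℤ) - 1) = q ^ j * q ^ ((N : ℤ) - 1) := by
      rw [← zpow_natCast q j, ← zpow_add₀ hq]; congr 1; push_cast; ring
    rw [hG, this]
    field_simp
  -- After the exchange of sums, the inner sum over m = k - j is balanced and supplies (c/z,
  -- d/z;q)_N with N = n - j.
  have hin := sum_balanced hq hq1 (X := a * z * q ^ j) (Y := G) (E := a * c * q ^ j)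
    (F := a * d * q ^ j) (mul_ne_zero (mul_ne_zero ha hz) (pow_ne_zero _ hq))
    (mul_ne_zero (mul_ne_zero ha hc) (pow_ne_zero _ hq)) N hbal
  have e1 : a * c * q ^ j / (a * z * q ^ j) = c / z := by field_simp
  have e2 : a * d * q ^ j / (a * z * q ^ j) = d / z := by field_simp
  rw [e1, e2] at hin
  have step2 : ∀ m ∈ range (N + 1),
      qPoch (q ^ (-((j + N : ℕ) : ℤ))) q (j + m) * q ^ (j + m) * qPoch (a * z) q (j + m)
        * (qPoch (a * b * q ^ (j + m)) q (j + N - (j + m))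
          * qPoch (a * c * q ^ (j + m)) q (j + N - (j + m))
          * qPoch (a * d * q ^ (j + m)) q (j + N - (j + m)))
        * (1 / (qPoch q q j * qPoch q q (j + m - j))
          * (G ^ j * qPoch (b * z) q j * qPoch v q j * qPoch G q (j + m - j)
            * qPoch (a * b * q ^ j) q (j + m - j)))
      = qPoch (q ^ (-((j + N : ℕ) : ℤ))) q j * q ^ j / qPoch q q j * qPoch (a * z) q j
        * (G ^ j * qPoch (b * z) q j * qPoch v q j * qPoch (a * b * q ^ j) q N)
        * (qPoch (q ^ (-(N : ℤ))) q m / qPoch q q m * q ^ m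
        * (qPoch (a * z * q ^ j) q m * qPoch G q m)
        * (qPoch (a * c * q ^ j * q ^ m) q (N - m) * qPoch (a * d * q ^ j * q ^ m) q (N - m))) := by
    intro m hm
    have hm' : m ≤ N := Nat.lt_succ_iff.1 (mem_range.1 hm)
    have e3 : q ^ (-((j + N : ℕ) : ℤ)) * q ^ j = q ^ (-(N : ℤ)) := by
      rw [← zpow_natCast q j, ← zpow_add₀ hq]; congr 1; push_cast; ring
    rw [show j + N - (j + m) = N - m by omega, show j + m - j = m by omega,
      qPoch_add (q ^ (-((j + N : ℕ) : ℤ))), qPoch_add (a * z), e3,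
      qPoch_split (a * b * q ^ j) q hm', pow_add, ← mul_assoc (a * b), ← mul_assoc (a * c),
      ← mul_assoc (a * d)]
    ring
  rw [sum_congr rfl step2, ← mul_sum, hin, qPoch_ratio hq hq1 hj', show j + N - j = N by omega]
  have hrev := prod_mul_qPoch_inv hq (mul_ne_zero hc hd) ((j + N : ℕ) : ℤ) j
  rw [← hv, show ((j + N : ℕ) : ℤ) - j = (N : ℤ) by push_cast; ring, zpow_natCast] at hrev
  rw [← hrev]
  -- The large powers of q from (q^{-n};q)_j, from G^j and from reversing (v;q)_j cancel; only
  -- powers of z and 1/z survive.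
  have e4 : (∏ i ∈ range j, (-(c * d * q ^ (((j + N : ℕ) : ℤ) - 1 - i))))
      = (∏ i ∈ range j, (-(c * d * q ^ i))) * (q ^ N) ^ j := by
    rw [← prod_range_reflect, ← card_range j, ← prod_const, card_range, ← prod_mul_distrib]
    refine prod_congr rfl fun i hi => ?_
    have := mem_range.1 hi
    rw [show ((j + N : ℕ) : ℤ) - 1 - ((j - 1 - i : ℕ) : ℤ) = ((i + N : ℕ) : ℤ) by omega,
      zpow_natCast, pow_add]
    ring
  have e5 : (∏ i ∈ range j, (-(q ^ (-((j + N : ℕ) : ℤ) + i)))) * (q ^ j * G ^ j)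
      = (∏ i ∈ range j, (-(c * d * q ^ i))) * (a * z⁻¹) ^ j := by
    rw [← mul_pow, ← card_range j, ← prod_const, ← prod_const, card_range, ← prod_mul_distrib,
      ← prod_mul_distrib]
    refine prod_congr rfl fun i _ => ?_
    have : q ^ (-((j + N : ℕ) : ℤ) + i) * (q * q ^ (((j + N : ℕ) : ℤ) - 1)) = q ^ i := by
      rw [← zpow_one_add₀ hq, ← zpow_add₀ hq, ← zpow_natCast q i]
      congr 1
      ring
    rw [hG]
    field_simp
    linear_combination -this
  rw [e4]
  have h1 := qPoch_self_ne_zero hq1 j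
  have h2 := qPoch_self_ne_zero hq1 N
  have e6 : (a ^ (j + N))⁻¹ * (a * z⁻¹) ^ j * (a * z * q ^ j) ^ N
      = z ^ N * (z⁻¹) ^ j * (q ^ N) ^ j := by
    rw [mul_pow, mul_pow, mul_pow, pow_add, ← pow_mul, ← pow_mul, mul_comm N j]
    field_simp
  linear_combination ((a ^ (j + N))⁻¹ * (qPoch q q (j + N) / qPoch q q N) / qPoch q q j
      * qPoch (a * z) q j * qPoch (b * z) q j * qPoch v q j * qPoch (a * b * q ^ j) q N
      * (a * z * q ^ j) ^ N * (qPoch (c / z) q N * qPoch (d / z) q N)) * e5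
    + ((∏ i ∈ range j, (-(c * d * q ^ i))) * (qPoch q q (j + N) / qPoch q q N) / qPoch q q j
      * qPoch (a * z) q j * qPoch (b * z) q j * qPoch v q j * qPoch (a * b * q ^ j) q N
      * (qPoch (c / z) q N * qPoch (d / z) q N)) * e6

/-- The convolution form is visibly symmetric in a and b, which the defining sum is not. Together
with the evident symmetry in b, c, d this permits any parameter to be distinguished. -/
theorem askeyWilson_swap_left (n : ℕ) {z a b c d q : ℂ} (hq : q ≠ 0) (hq1 : ‖q‖ < 1)
    (hz : z ≠ 0) (ha : a ≠ 0) (hb : b ≠ 0) (hc : c ≠ 0) (hd : d ≠ 0) :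
    askeyWilson n ((z + z⁻¹) / 2) a b c d q = askeyWilson n ((z + z⁻¹) / 2) b a c d q := by
  rw [askeyWilson_eq_convolution n hq hq1 hz ha hc hd,
    askeyWilson_eq_convolution n hq hq1 hz hb hc hd]
  refine sum_congr rfl fun j _ => ?_
  rw [mul_comm b a]
  ring

theorem askeyWilson_swap_middle (n : ℕ) {z : ℂ} (a b c d q : ℂ) (hz : z ≠ 0) :
    askeyWilson n ((z + z⁻¹) / 2) a b c d q = askeyWilson n ((z + z⁻¹) / 2) a c b d q := by
  rw [askeyWilson_eq_sum n a b c d q hz, askeyWilson_eq_sum n a c b d q hz]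
  congr 1
  refine sum_congr rfl fun j _ => ?_
  rw [show a * c * b * d = a * b * c * d by ring]
  ring

/-- The third parameter as the distinguished one. -/
theorem askeyWilson_rotate (n : ℕ) {z a b c d q : ℂ} (hq : q ≠ 0) (hq1 : ‖q‖ < 1)
    (hz : z ≠ 0) (ha : a ≠ 0) (hb : b ≠ 0) (hc : c ≠ 0) (hd : d ≠ 0) :
    askeyWilson n ((z + z⁻¹) / 2) a b c d q = askeyWilson n ((z + z⁻¹) / 2) c a b d q := by
  rw [askeyWilson_swap_middle n a b c d q hz, askeyWilson_swap_left n hq hq1 hz ha hc hb hd]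

/-! ### Inversion of the defining sum: (ez, e/z;q)_m in terms of p_k. -/

/-- The orthogonality relation behind Bailey inversion. For N > 0 the partial sums up to M, times 1
- q^{-N}, are products containing (q^{-N};q)_{M+1}, which vanishes at M = N. -/
theorem sum_bailey_inversion {q A : ℂ} (hq : q ≠ 0) (hq1 : ‖q‖ < 1) (N : ℕ)
    (hA : ∀ i : ℕ, A * q ^ (N + 1) * q ^ i ≠ 1) :
    ∑ i ∈ range (N + 1), q ^ (N * i) * (qPoch (q ^ (-(N : ℤ))) q i * (1 - A * q ^ (2 * i))
      * qPoch A q i / (qPoch q q i * qPoch (A * q ^ (N + 1)) q i)) = if N = 0 then 1 - A else 0 := by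
  split_ifs with hN
  · subst hN; simp [qPoch_zero]
  have partialSum : ∀ M : ℕ, (1 - q ^ (-(N : ℤ))) * ∑ i ∈ range (M + 1), q ^ (N * i) *
      (qPoch (q ^ (-(N : ℤ))) q i * (1 - A * q ^ (2 * i))
      * qPoch A q i / (qPoch q q i * qPoch (A * q ^ (N + 1)) q i))
      = q ^ (N * M) * (qPoch (q ^ (-(N : ℤ))) q (M + 1) * qPoch A q (M + 1)
        / (qPoch q q M * qPoch (A * q ^ (N + 1)) q M)) := by
    intro M
    induction M with
    | zero => simp [qPoch_zero, qPoch_succ]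
    | succ M ih =>
      rw [sum_range_succ, mul_add, ih]
      have h1 := qPoch_self_ne_zero hq1 M
      have h2 : qPoch (A * q ^ (N + 1)) q M ≠ 0 := qPoch_ne_zero (n := M) (fun j _ => hA j) le_rfl
      have h3 : 1 - q * q ^ M ≠ 0 := by
        rw [← pow_succ']; exact sub_ne_zero.2 (pow_succ_ne_one hq1 M).symm
      have h4 : 1 - A * q ^ (N + 1) * q ^ M ≠ 0 := sub_ne_zero.2 (hA M).symm
      have h5 : q ^ N ≠ 0 := pow_ne_zero _ hq
      have e1 : q ^ (-(N : ℤ)) = (q ^ N)⁻¹ := by rw [zpow_neg, zpow_natCast]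
      have e2 : q ^ (N * (M + 1)) = q ^ (N * M) * q ^ N := by rw [← pow_add]; ring_nf
      have e3 : q ^ (2 * (M + 1)) = (q ^ M * q) ^ 2 := by rw [← pow_succ, ← pow_mul, mul_comm]
      rw [e2, e3, qPoch_succ _ _ (M + 1), qPoch_succ A q (M + 1), qPoch_succ q q M,
        qPoch_succ (A * q ^ (N + 1)) q M, e1]
      simp only [pow_succ q] at *
      generalize qPoch (A * (q ^ N * q)) q M = B at *
      generalize qPoch A q (M + 1) = B' at *
      generalize qPoch (q ^ N)⁻¹ q (M + 1) = B'' at *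
      generalize qPoch q q M = C at *
      generalize q ^ (N * M) = y at *
      generalize q ^ M = x at *
      generalize q ^ N = w at *
      generalize hd1 : 1 - q * x = d1 at *
      generalize hd2 : 1 - A * (w * q) * x = d2 at *
      field_simp
      rw [← hd1, ← hd2]
      ring
  have h := partialSum N
  rw [qPoch_neg_pow_eq_zero hq (Nat.lt_succ_self N)] at h
  have hne : 1 - q ^ (-(N : ℤ)) ≠ 0 := by
    obtain ⟨M, rfl⟩ := Nat.exists_eq_succ_of_ne_zero hN
    rw [zpow_neg, zpow_natCast]
    exact sub_ne_zero.2 (fun h => pow_succ_ne_one hq1 M (inv_eq_one.1 h.symm))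
  rw [zero_mul, zero_div, mul_zero] at h
  exact (mul_eq_zero.1 h).resolve_left hne

theorem prod_neg_zpow_shift {q : ℂ} (hq : q ≠ 0) (j i : ℕ) :
    (∏ l ∈ range j, (-(q ^ (-((j + i : ℕ) : ℤ) + l)))) * q ^ (j * i)
      = ∏ l ∈ range j, (-(q ^ (-(j : ℤ) + l))) := by
  rw [mul_comm j i, pow_mul, ← card_range j, ← prod_const, card_range, ← prod_mul_distrib]
  refine prod_congr rfl fun l _ => ?_
  rw [neg_mul, ← zpow_natCast q i, ← zpow_add₀ hq]
  congr 2
  push_cast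
  ring

/-- The product equals (-1)^m q^{-m(m+1)/2}. It occurs twice in the surviving term of the inversion,
once from each of the factors (q^{-m};q)_m. -/
theorem prod_neg_zpow_sq {q : ℂ} (hq : q ≠ 0) (m : ℕ) :
    (∏ l ∈ range m, (-(q ^ (-(m : ℤ) + l)))) ^ 2 * (q ^ (m * m) * q ^ m) = 1 := by
  have h : (∏ l ∈ range m, (-(q ^ (-(m : ℤ) + l)))) = ∏ l ∈ range m, (-(q ^ (-(l : ℤ) - 1))) := by
    rw [← prod_range_reflect]
    refine prod_congr rfl fun i hi => ?_
    have := mem_range.1 hi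
    congr 2
    omega
  rw [sq]
  nth_rewrite 2 [h]
  rw [pow_mul, ← mul_pow, ← card_range m, ← prod_const, card_range, ← prod_mul_distrib, ← prod_mul_distrib]
  refine prod_eq_one fun l _ => ?_
  rw [neg_mul_neg, ← zpow_natCast q m, ← zpow_add_one₀ hq, ← zpow_add₀ hq, ← zpow_add₀ hq]
  ring_nf
  simp

/-- The `x`-independent weight of `p_k(x; a, b, e, f | q)` in the expansions. -/
noncomputable def expansionWeight (a b e f q : ℂ) (k : ℕ) : ℂ :=
  qPoch (a * b * e * f) q (2 * k) * qPoch (a * b * e * f / q) q k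
    / (qPoch (a * b * e * f / q) q (2 * k)
      * (qPoch q q k * qPoch (a * e) q k * qPoch (b * e) q k * qPoch (e * f) q k))

/-- With r = abef/q this exposes the very-well-poised factor of the expansion weight, as the
orthogonality relation requires. -/
theorem qPoch_two_mul_ratio {r q : ℂ} (hr : ∀ j : ℕ, r * q ^ j ≠ 1) (k : ℕ) :
    qPoch (r * q) q (2 * k) / qPoch r q (2 * k) = (1 - r * q ^ (2 * k)) / (1 - r) := by
  have h0 : 1 - r ≠ 0 := sub_ne_zero.2 (by simpa using (hr 0).symm)
  have h1 : qPoch r q (2 * k) ≠ 0 := qPoch_ne_zero (n := 2 * k) (fun j _ => hr j) le_rfl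
  rw [div_eq_div_iff h1 h0, mul_comm _ (1 - r), ← qPoch_succ', qPoch_succ]
  ring

/-- The expansion of `(ez, e/z; q)_m` in Askey--Wilson polynomials. -/
theorem sum_expansionWeight_mul_askeyWilson {q z a b e f : ℂ} (hq : q ≠ 0) (hq1 : ‖q‖ < 1)
    (hz : z ≠ 0) (he : e ≠ 0)
    (hae : ∀ j : ℕ, a * e * q ^ j ≠ 1) (hbe : ∀ j : ℕ, b * e * q ^ j ≠ 1)
    (hef : ∀ j : ℕ, e * f * q ^ j ≠ 1) (hs : ∀ j : ℕ, a * b * e * f / q * q ^ j ≠ 1) (m : ℕ) :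
    ∑ k ∈ range (m + 1), (e * q ^ m) ^ k * (qPoch (q ^ (-(m : ℤ))) q k
        / qPoch (a * b * e * f * q ^ m) q k) * (expansionWeight a b e f q k
        * askeyWilson k ((z + z⁻¹) / 2) e a b f q)
      = qPoch (a * b * e * f) q m * (qPoch (e * z) q m * qPoch (e / z) q m)
        / (qPoch (a * e) q m * qPoch (b * e) q m * qPoch (e * f) q m) := by
  set r := a * b * e * f / q with hr
  have hrq : a * b * e * f = r * q := by rw [hr]; field_simp
  have n1 : ∀ k, qPoch (a * e) q k ≠ 0 := fun k => qPoch_ne_zero (n := k) (fun j _ => hae j) le_rfl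
  have n2 : ∀ k, qPoch (b * e) q k ≠ 0 := fun k => qPoch_ne_zero (n := k) (fun j _ => hbe j) le_rfl
  have n3 : ∀ k, qPoch (e * f) q k ≠ 0 := fun k => qPoch_ne_zero (n := k) (fun j _ => hef j) le_rfl
  have n4 : ∀ k, qPoch q q k ≠ 0 := qPoch_self_ne_zero hq1
  have n5 : ∀ i k, qPoch (r * q * q ^ i) q k ≠ 0 := fun i k =>
    qPoch_ne_zero (n := k) (fun j _ => by
      have := hs (i + j + 1)
      rwa [show r * q * q ^ i * q ^ j = r * q ^ (i + j + 1) by ring]) le_rfl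
  have n6 : 1 - r ≠ 0 := sub_ne_zero.2 (by simpa using (hs 0).symm)
  have step1 : ∀ k ∈ range (m + 1), (e * q ^ m) ^ k * (qPoch (q ^ (-(m : ℤ))) q k
        / qPoch (a * b * e * f * q ^ m) q k) * (expansionWeight a b e f q k
        * askeyWilson k ((z + z⁻¹) / 2) e a b f q)
      = ∑ j ∈ range (k + 1), q ^ (m * k) * (qPoch (q ^ (-(m : ℤ))) q k / qPoch (r * q * q ^ m) q k)
        * ((1 - r * q ^ (2 * k)) / (1 - r) * qPoch r q k / qPoch q q k)
        * (qPoch (q ^ (-(k : ℤ))) q j / qPoch q q j * q ^ j * qPoch (r * q ^ k) q j)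
        * ((qPoch (e * z) q j * qPoch (e / z) q j)
          / (qPoch (a * e) q j * qPoch (b * e) q j * qPoch (e * f) q j)) := by
    intro k _
    rw [askeyWilson_eq_sum k e a b f q hz, expansionWeight, ← hr, hrq]
    have e1 : qPoch (r * q) q (2 * k) * qPoch r q k / (qPoch r q (2 * k) *
        (qPoch q q k * qPoch (a * e) q k * qPoch (b * e) q k * qPoch (e * f) q k))
        = (1 - r * q ^ (2 * k)) / (1 - r) * qPoch r q k / qPoch q q k
          * (1 / (qPoch (a * e) q k * qPoch (b * e) q k * qPoch (e * f) q k)) := by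
      rw [← qPoch_two_mul_ratio hs]
      simp only [div_eq_mul_inv, mul_inv]
      ring
    rw [e1, mul_pow, ← pow_mul, mul_sum, mul_sum, mul_sum]
    refine sum_congr rfl fun j hj => ?_
    have hj' : j ≤ k := Nat.lt_succ_iff.1 (mem_range.1 hj)
    have e2 : q ^ ((k : ℤ) - 1) * (e * a * b * f) = r * q ^ k := by
      rw [show e * a * b * f = r * q by rw [← hrq]; ring, zpow_sub_one₀ hq, zpow_natCast]
      field_simp
    rw [e2, mul_comm e a, mul_comm e b]
    have e3 : ∀ u : ℂ, (∀ k, qPoch u q k ≠ 0) →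
        qPoch (u * q ^ j) q (k - j) / qPoch u q k = 1 / qPoch u q j := by
      intro u hu
      rw [div_eq_div_iff (hu k) (hu j), qPoch_split u q hj']
      ring
    have he0 : e ^ k * (e ^ k)⁻¹ = 1 := mul_inv_cancel₀ (pow_ne_zero _ he)
    calc _ = (e ^ k * (e ^ k)⁻¹)
          * (q ^ (m * k) * (qPoch (q ^ (-(m : ℤ))) q k / qPoch (r * q * q ^ m) q k)
          * ((1 - r * q ^ (2 * k)) / (1 - r) * qPoch r q k / qPoch q q k)
          * (qPoch (q ^ (-(k : ℤ))) q j / qPoch q q j * q ^ j * qPoch (r * q ^ k) q j))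
          * (qPoch (e * z) q j * qPoch (e / z) q j)
          * ((qPoch (a * e * q ^ j) q (k - j) / qPoch (a * e) q k)
            * (qPoch (b * e * q ^ j) q (k - j) / qPoch (b * e) q k)
            * (qPoch (e * f * q ^ j) q (k - j) / qPoch (e * f) q k)) := by
          simp only [div_eq_mul_inv, mul_inv]; ring
      _ = _ := by
          rw [he0, e3 _ n1, e3 _ n2, e3 _ n3]
          simp only [div_eq_mul_inv, mul_inv]; ring
  rw [sum_congr rfl step1, sum_range_triangle]
  -- With k = j + i, the sum over i is the orthogonality relation for A = rq^{2j} and N = m - j, so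
  -- only j = m contributes.
  have step2 : ∀ j ∈ range (m + 1), ∑ i ∈ range (m - j + 1),
        q ^ (m * (j + i)) * (qPoch (q ^ (-(m : ℤ))) q (j + i) / qPoch (r * q * q ^ m) q (j + i))
        * ((1 - r * q ^ (2 * (j + i))) / (1 - r) * qPoch r q (j + i) / qPoch q q (j + i))
        * (qPoch (q ^ (-((j + i : ℕ) : ℤ))) q j / qPoch q q j * q ^ j * qPoch (r * q ^ (j + i)) q j)
        * ((qPoch (e * z) q j * qPoch (e / z) q j)
          / (qPoch (a * e) q j * qPoch (b * e) q j * qPoch (e * f) q j))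
      = q ^ (m * j) * (∏ l ∈ range j, (-(q ^ (-(j : ℤ) + l)))) * q ^ j / qPoch q q j
        * ((qPoch (e * z) q j * qPoch (e / z) q j)
          / (qPoch (a * e) q j * qPoch (b * e) q j * qPoch (e * f) q j))
        * (qPoch (q ^ (-(m : ℤ))) q j * qPoch r q (2 * j) / (qPoch (r * q * q ^ m) q j * (1 - r)))
        * (if m - j = 0 then 1 - r * q ^ (2 * j) else 0) := by
    intro j hj
    have hj' : j ≤ m := Nat.lt_succ_iff.1 (mem_range.1 hj)
    obtain ⟨N, rfl⟩ := Nat.exists_eq_add_of_le hj'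
    rw [show j + N - j = N by omega]
    rw [← sum_bailey_inversion (A := r * q ^ (2 * j)) hq hq1 N (fun i => by
      have := hs (2 * j + (N + 1) + i)
      rwa [pow_add, pow_add, ← mul_assoc, ← mul_assoc] at this), mul_sum]
    refine sum_congr rfl fun i _ => ?_
    have e1 : q ^ (-((j + N : ℕ) : ℤ)) * q ^ j = q ^ (-(N : ℤ)) := by
      rw [← zpow_natCast q j, ← zpow_add₀ hq]; congr 1; push_cast; ring
    have e2 : r * q * q ^ (j + N) * q ^ j = r * q ^ (2 * j) * q ^ (N + 1) := by ring
    have e3 : qPoch r q (j + i) * qPoch (r * q ^ (j + i)) q j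
        = qPoch r q (2 * j) * qPoch (r * q ^ (2 * j)) q i := by
      rw [← qPoch_add, ← qPoch_add]; congr 1; ring
    have e4 : q ^ (2 * (j + i)) = q ^ (2 * j) * q ^ (2 * i) := by rw [← pow_add]; ring_nf
    have e5 : q ^ ((j + N) * (j + i)) = q ^ ((j + N) * j) * q ^ (j * i) * q ^ (N * i) := by
      rw [← pow_add, ← pow_add]; ring_nf
    rw [qPoch_add (q ^ (-((j + N : ℕ) : ℤ))), e1, qPoch_add (r * q * q ^ (j + N)), e2, e4, e5,
      qPoch_ratio hq hq1 (Nat.le_add_right j i), show j + i - j = i by omega,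
      ← prod_neg_zpow_shift hq j i]
    have c : qPoch q q (j + i) * (qPoch q q (j + i))⁻¹ = 1 := mul_inv_cancel₀ (n4 _)
    calc _ = (qPoch q q (j + i) * (qPoch q q (j + i))⁻¹)
          * (qPoch r q (j + i) * qPoch (r * q ^ (j + i)) q j)
          * (q ^ ((j + N) * j) * q ^ (j * i) * q ^ (N * i)
          * (qPoch (q ^ (-((j + N : ℕ) : ℤ))) q j * qPoch (q ^ (-(N : ℤ))) q i
            / (qPoch (r * q * q ^ (j + N)) q j * qPoch (r * q ^ (2 * j) * q ^ (N + 1)) q i))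
          * ((1 - r * (q ^ (2 * j) * q ^ (2 * i))) / (1 - r))
          * ((∏ l ∈ range j, (-(q ^ (-((j + i : ℕ) : ℤ) + l)))) * (1 / qPoch q q i)
            / qPoch q q j * q ^ j)
          * ((qPoch (e * z) q j * qPoch (e / z) q j)
            / (qPoch (a * e) q j * qPoch (b * e) q j * qPoch (e * f) q j))) := by
          simp only [div_eq_mul_inv, mul_inv]; ring
      _ = _ := by
          rw [c, e3]
          simp only [div_eq_mul_inv, mul_inv]; ring
  rw [sum_congr rfl step2, sum_eq_single m]
  · rw [Nat.sub_self, if_pos rfl]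
    have e1 := qPoch_two_mul_ratio hs m
    have e2 : qPoch (r * q) q (2 * m) = qPoch (r * q) q m * qPoch (r * q * q ^ m) q m := by
      rw [two_mul, qPoch_add]
    have n7 : qPoch r q (2 * m) ≠ 0 := qPoch_ne_zero (n := 2 * m) (fun j _ => hs j) le_rfl
    rw [e2, div_eq_div_iff n7 n6] at e1
    have e3 : qPoch r q (2 * m) * (1 - r * q ^ (2 * m)) / (qPoch (r * q * q ^ m) q m * (1 - r))
        = qPoch (r * q) q m := by
      rw [div_eq_iff (mul_ne_zero (n5 m m) n6)]
      linear_combination -e1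
    have e4 := prod_neg_zpow_sq hq m
    have c : qPoch q q m * (qPoch q q m)⁻¹ = 1 := mul_inv_cancel₀ (n4 _)
    rw [qPoch_ratio hq hq1 le_rfl, Nat.sub_self, qPoch_zero, hrq, div_one]
    calc _ = ((∏ l ∈ range m, (-(q ^ (-(m : ℤ) + l)))) ^ 2 * (q ^ (m * m) * q ^ m))
          * (qPoch q q m * (qPoch q q m)⁻¹)
          * (qPoch r q (2 * m) * (1 - r * q ^ (2 * m)) / (qPoch (r * q * q ^ m) q m * (1 - r)))
          * ((qPoch (e * z) q m * qPoch (e / z) q m)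
            / (qPoch (a * e) q m * qPoch (b * e) q m * qPoch (e * f) q m)) := by
          simp only [div_eq_mul_inv, mul_inv]; ring
      _ = _ := by rw [e4, c, e3]; ring
  · intro j hj hjm
    have hj' : j ≤ m := Nat.lt_succ_iff.1 (mem_range.1 hj)
    rw [if_neg (by omega), mul_zero]
  · intro h
    exact absurd (mem_range.2 (Nat.lt_succ_self m)) h

/-! ### Uniform bounds and analyticity. -/

theorem geom_sum_le_inv {r : ℝ} (h0 : 0 ≤ r) (h1 : r < 1) (n : ℕ) :
    ∑ j ∈ range n, r ^ j ≤ (1 - r)⁻¹ := by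
  rw [← tsum_geometric_of_lt_one h0 h1]
  exact (summable_geometric_of_lt_one h0 h1).sum_le_tsum _ (fun j _ => pow_nonneg h0 j)

theorem prod_one_add_geometric_le {q : ℂ} (hq1 : ‖q‖ < 1) {t : ℝ} (ht : 0 ≤ t) (n : ℕ) :
    ∏ j ∈ range n, (1 + t * ‖q‖ ^ j) ≤ Real.exp (t / (1 - ‖q‖)) := by
  refine (Real.prod_one_add_le_exp_sum (f := fun j : ℕ => t * ‖q‖ ^ j) (range n)
    (fun j => by positivity)).trans ?_
  rw [Real.exp_le_exp, ← mul_sum, div_eq_mul_inv]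
  exact mul_le_mul_of_nonneg_left (geom_sum_le_inv (norm_nonneg q) hq1 n) ht

theorem norm_qPoch_le {q : ℂ} (hq1 : ‖q‖ < 1) {a : ℂ} {t : ℝ} (ha : ‖a‖ ≤ t) (n : ℕ) :
    ‖qPoch a q n‖ ≤ Real.exp (t / (1 - ‖q‖)) := by
  refine le_trans ?_ (prod_one_add_geometric_le hq1 ((norm_nonneg a).trans ha) n)
  rw [qPoch, norm_prod]
  refine prod_le_prod (fun j _ => norm_nonneg _) fun j _ => ?_
  refine (norm_sub_le _ _).trans ?_
  rw [norm_one, norm_mul, norm_pow]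
  gcongr

theorem norm_qPochInf_le {q : ℂ} (hq1 : ‖q‖ < 1) {a : ℂ} {t : ℝ} (ha : ‖a‖ ≤ t) :
    ‖qPochInf a q‖ ≤ Real.exp (t / (1 - ‖q‖)) :=
  le_of_tendsto (tendsto_qPoch_qPochInf a hq1).norm
    (Filter.Eventually.of_forall fun n => norm_qPoch_le hq1 ha n)

theorem qPochInf_eq_mul {q : ℂ} (hq1 : ‖q‖ < 1) (a : ℂ) (n : ℕ) :
    qPochInf a q = qPoch a q n * qPochInf (a * q ^ n) q := by
  have h1 := (Filter.tendsto_add_atTop_iff_nat n).2 (tendsto_qPoch_qPochInf a hq1)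
  have h2 := (tendsto_qPoch_qPochInf (a * q ^ n) hq1).const_mul (qPoch a q n)
  refine tendsto_nhds_unique h1 (h2.congr fun m => ?_)
  rw [← qPoch_add, add_comm]

theorem summable_norm_mul_pow {q : ℂ} (hq1 : ‖q‖ < 1) (a : ℂ) :
    Summable fun j : ℕ => ‖-(a * q ^ j)‖ := by
  simpa [norm_mul, norm_pow] using
    (summable_geometric_of_lt_one (norm_nonneg q) hq1).mul_left ‖a‖

theorem qPochInf_ne_zero {q : ℂ} (hq1 : ‖q‖ < 1) {a : ℂ} (ha : ∀ j : ℕ, a * q ^ j ≠ 1) :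
    qPochInf a q ≠ 0 := by
  have := tprod_one_add_ne_zero_of_summable (f := fun j : ℕ => -(a * q ^ j))
    (fun j => by rw [← sub_eq_add_neg]; exact sub_ne_zero.2 (ha j).symm)
    (summable_norm_mul_pow hq1 a)
  simpa only [← sub_eq_add_neg, qPochInf] using this

theorem mul_pow_ne_one_of_norm_lt_one {q : ℂ} (hq1 : ‖q‖ < 1) {a : ℂ} (ha : ‖a‖ < 1) (j : ℕ) :
    a * q ^ j ≠ 1 := by
  intro h
  have h2 := congrArg norm h
  rw [norm_mul, norm_pow, norm_one] at h2
  exact (mul_lt_one_of_nonneg_of_lt_one_left (norm_nonneg a) ha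
    (pow_le_one₀ (norm_nonneg q) hq1.le)).ne h2

/-- The partial products converge to a nonzero limit, so their inverses converge and are bounded. -/
theorem exists_norm_inv_qPoch_le {q : ℂ} (hq1 : ‖q‖ < 1) {a : ℂ}
    (ha : ∀ j : ℕ, a * q ^ j ≠ 1) : ∃ C : ℝ, ∀ n, ‖(qPoch a q n)⁻¹‖ ≤ C := by
  have h := (tendsto_qPoch_qPochInf a hq1).inv₀ (qPochInf_ne_zero hq1 ha)
  obtain ⟨C, hC⟩ := (Metric.isBounded_range_of_tendsto _ h).exists_norm_le
  exact ⟨C, fun n => hC _ ⟨n, rfl⟩⟩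

/-- The partial products are polynomials in a that converge locally uniformly, with a geometric
majorant on the ball of radius ‖a‖ + 1. -/
theorem differentiable_qPochInf {q : ℂ} (hq1 : ‖q‖ < 1) :
    Differentiable ℂ fun a => qPochInf a q := by
  intro a
  have hprod : HasProdLocallyUniformlyOn (fun (j : ℕ) (a : ℂ) => 1 + -(a * q ^ j))
      (fun a => ∏' j : ℕ, (1 + -(a * q ^ j))) (Metric.ball (0 : ℂ) (‖a‖ + 1)) := by
    refine Summable.hasProdLocallyUniformlyOn_nat_one_add Metric.isOpen_ball
      ((summable_geometric_of_lt_one (norm_nonneg q) hq1).mul_left (‖a‖ + 1))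
      (Filter.Eventually.of_forall fun j x hx => ?_) (fun j => by fun_prop)
    rw [norm_neg, norm_mul, norm_pow]
    have : ‖x‖ < ‖a‖ + 1 := by simpa using hx
    gcongr
  have hd := hprod.differentiableOn (Filter.Eventually.of_forall fun s => by
    simpa [Finset.prod_fn] using DifferentiableOn.finsetProd (fun _ _ => by fun_prop))
    Metric.isOpen_ball
  have := hd.differentiableAt (x := a) (Metric.isOpen_ball.mem_nhds (by simp))
  simpa only [← sub_eq_add_neg, qPochInf] using this

/-- Growth of the Askey--Wilson polynomials in the degree. -/
theorem exists_norm_askeyWilson_le {z a b c d q : ℂ} (hq : q ≠ 0) (hq1 : ‖q‖ < 1)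
    (hz : z ≠ 0) (ha : a ≠ 0) (hc : c ≠ 0) (hd : d ≠ 0) :
    ∃ C : ℝ, 0 ≤ C ∧ ∀ n, ‖askeyWilson n ((z + z⁻¹) / 2) a b c d q‖
      ≤ C * ((n + 1) * max ‖z‖ ‖z⁻¹‖ ^ n) := by
  obtain ⟨C₀, hC₀⟩ := exists_norm_inv_qPoch_le (a := q) hq1 (fun j => by
    rw [← pow_succ']; exact pow_succ_ne_one hq1 j)
  have hC₀' : 0 ≤ C₀ := (norm_nonneg _).trans (hC₀ 0)
  set M := max ‖z‖ ‖z⁻¹‖ with hM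
  set E : ℂ → ℝ := fun u => Real.exp (‖u‖ / (1 - ‖q‖)) with hE
  have bd : ∀ u n, ‖qPoch u q n‖ ≤ E u := fun u n => norm_qPoch_le hq1 le_rfl n
  have bd' : ∀ u n m, ‖qPoch (u * q ^ m) q n‖ ≤ E u := fun u n m => norm_qPoch_le hq1 (by
    rw [norm_mul, norm_pow]
    exact mul_le_of_le_one_right (norm_nonneg u) (pow_le_one₀ (norm_nonneg q) hq1.le)) n
  have hE0 : ∀ u, 0 ≤ E u := fun u => Real.exp_nonneg _
  refine ⟨(E q * (C₀ * C₀)) * (E (a * z) * E (b * z)) * (E (c / z) * E (d / z))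
    * (E (a * b) * E (c * d)), by positivity, fun n => ?_⟩
  -- The defining sum is useless here: its factors (q^{-n};q)_k grow like q^{-n²/2} and bounds would
  -- have to exploit cancellation. In the convolution every shifted factorial is bounded uniformly
  -- in n and j.
  rw [askeyWilson_eq_convolution n hq hq1 hz ha hc hd]
  refine (norm_sum_le _ _).trans ?_
  calc _ ≤ ∑ j ∈ range (n + 1), (E q * (C₀ * C₀)) * M ^ n * (E (a * z) * E (b * z))
        * (E (c / z) * E (d / z)) * (E (a * b) * E (c * d)) := by
        refine sum_le_sum fun j hj => ?_
        have hj' : j ≤ n := Nat.lt_succ_iff.1 (mem_range.1 hj)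
        have hMn : ‖z‖ ^ (n - j) * ‖z⁻¹‖ ^ j ≤ M ^ n := by
          calc _ ≤ M ^ (n - j) * M ^ j := by
                gcongr
                · exact le_max_left _ _
                · exact le_max_right _ _
            _ = M ^ n := by rw [← pow_add, Nat.sub_add_cancel hj']
        rw [div_eq_mul_inv, mul_inv]
        simp only [norm_mul, norm_pow]
        gcongr
        exacts [bd _ _, hC₀ _, hC₀ _, bd _ _, bd _ _, bd _ _, bd _ _, bd' _ _ _, bd' _ _ _]
    _ = _ := by
        rw [sum_const, card_range, nsmul_eq_mul]
        push_cast
        ring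

theorem exists_norm_expansionWeight_le {a b e f q : ℂ} (hq1 : ‖q‖ < 1)
    (hae : ∀ j : ℕ, a * e * q ^ j ≠ 1) (hbe : ∀ j : ℕ, b * e * q ^ j ≠ 1)
    (hef : ∀ j : ℕ, e * f * q ^ j ≠ 1) (hs : ∀ j : ℕ, a * b * e * f / q * q ^ j ≠ 1) :
    ∃ C : ℝ, 0 ≤ C ∧ ∀ k, ‖expansionWeight a b e f q k‖ ≤ C := by
  obtain ⟨C₀, hC₀⟩ := exists_norm_inv_qPoch_le (a := q) hq1 (fun j => by
    rw [← pow_succ']; exact pow_succ_ne_one hq1 j)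
  obtain ⟨C₁, hC₁⟩ := exists_norm_inv_qPoch_le hq1 hae
  obtain ⟨C₂, hC₂⟩ := exists_norm_inv_qPoch_le hq1 hbe
  obtain ⟨C₃, hC₃⟩ := exists_norm_inv_qPoch_le hq1 hef
  obtain ⟨C₄, hC₄⟩ := exists_norm_inv_qPoch_le hq1 hs
  have p0 : 0 ≤ C₀ := (norm_nonneg _).trans (hC₀ 0)
  have p1 : 0 ≤ C₁ := (norm_nonneg _).trans (hC₁ 0)
  have p2 : 0 ≤ C₂ := (norm_nonneg _).trans (hC₂ 0)
  have p3 : 0 ≤ C₃ := (norm_nonneg _).trans (hC₃ 0)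
  have p4 : 0 ≤ C₄ := (norm_nonneg _).trans (hC₄ 0)
  refine ⟨Real.exp (‖a * b * e * f‖ / (1 - ‖q‖)) * Real.exp (‖a * b * e * f / q‖ / (1 - ‖q‖))
    * (C₄ * (C₀ * C₁ * C₂ * C₃)), by positivity, fun k => ?_⟩
  rw [expansionWeight, div_eq_mul_inv]
  simp only [mul_inv, norm_mul]
  gcongr
  exacts [by simpa using norm_qPoch_le hq1 (a := a * b * e * f) le_rfl _,
    by simpa using norm_qPoch_le hq1 (a := a * b * e * f / q) le_rfl _, hC₄ _, hC₀ _, hC₁ _, hC₂ _, hC₃ _]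

/-- The left side is polynomial in c, hence analytic at c = 0, where the points of the continuation
argument accumulate. -/
theorem prod_sub_eq {c : ℂ} (hc : c ≠ 0) (e q : ℂ) (k : ℕ) :
    ∏ i ∈ range k, (c - e * q ^ i) = c ^ k * qPoch (e / c) q k := by
  rw [qPoch, ← card_range k, ← prod_const, card_range, ← prod_mul_distrib]
  refine prod_congr rfl fun i _ => ?_
  field_simp

theorem norm_prod_sub_le {q : ℂ} (hq1 : ‖q‖ < 1) {r : ℝ} (hr : 0 < r) {c : ℂ} (hc : ‖c‖ ≤ r)
    (e : ℂ) (k : ℕ) :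
    ‖∏ i ∈ range k, (c - e * q ^ i)‖ ≤ r ^ k * Real.exp (‖e‖ / r / (1 - ‖q‖)) := by
  refine le_trans ?_ (mul_le_mul_of_nonneg_left
    (prod_one_add_geometric_le hq1 (t := ‖e‖ / r) (by positivity) k) (by positivity))
  rw [norm_prod, ← card_range k, ← prod_const, card_range, ← prod_mul_distrib]
  refine prod_le_prod (fun _ _ => norm_nonneg _) fun i _ => ?_
  refine (norm_sub_le _ _).trans ?_
  rw [norm_mul, norm_pow]
  have : r * (1 + ‖e‖ / r * ‖q‖ ^ i) = r + ‖e‖ * ‖q‖ ^ i := by field_simp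
  rw [this]
  gcongr

/-! ### Expansion of the infinite product quotient, by analytic continuation. -/

/-- The expansion of `(ez, e/z; q)_∞ / (cz, c/z; q)_∞` in Askey--Wilson polynomials. -/
theorem hasSum_expansionWeight_mul_askeyWilson {q z a b c e f : ℂ} (hq : q ≠ 0) (hq1 : ‖q‖ < 1)
    (hz : z ≠ 0) (ha : a ≠ 0) (hb : b ≠ 0) (hc : c ≠ 0) (he : e ≠ 0) (hf : f ≠ 0)
    (hcz : ‖c * z‖ < 1) (hcz' : ‖c / z‖ < 1)
    (hae : ∀ j : ℕ, a * e * q ^ j ≠ 1) (hbe : ∀ j : ℕ, b * e * q ^ j ≠ 1)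
    (hef : ∀ j : ℕ, e * f * q ^ j ≠ 1) (hs : ∀ j : ℕ, a * b * e * f / q * q ^ j ≠ 1)
    (habcf : ∀ j : ℕ, a * b * c * f * q ^ j ≠ 1) :
    HasSum (fun k : ℕ => c ^ k * qPoch (e / c) q k / qPoch (a * b * c * f) q k
        * (expansionWeight a b e f q k * askeyWilson k ((z + z⁻¹) / 2) e a b f q))
      (qPochInf (a * c) q * qPochInf (b * c) q * qPochInf (c * f) q * qPochInf (a * b * e * f) q
          * qPochInf (e * z) q * qPochInf (e / z) q
        / (qPochInf (a * e) q * qPochInf (b * e) q * qPochInf (e * f) q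
          * qPochInf (a * b * c * f) q * qPochInf (c * z) q * qPochInf (c / z) q)) := by
  set t : ℕ → ℂ := fun k => expansionWeight a b e f q k
    * askeyWilson k ((z + z⁻¹) / 2) e a b f q with ht
  set M := max ‖z‖ ‖z⁻¹‖ with hM
  have hM0 : 0 < M := (norm_pos_iff.2 hz).trans_le (le_max_left _ _)
  obtain ⟨C₁, hC₁, hw⟩ := exists_norm_expansionWeight_le hq1 hae hbe hef hs
  obtain ⟨C₂, hC₂, hp⟩ := exists_norm_askeyWilson_le (b := a) hq hq1 hz he hb hf
  have hcM : ‖c‖ * M < 1 := by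
    rw [hM, mul_max_of_nonneg _ _ (norm_nonneg c), ← norm_mul, ← norm_mul, ← div_eq_mul_inv]
    exact max_lt hcz hcz'
  -- A radius with |c| < r < 1/M: the disc contains c, and rM < 1 makes the series converge
  -- uniformly on it.
  obtain ⟨r, hcr, hr1⟩ := exists_between ((lt_div_iff₀ hM0).2 hcM)
  have hr0 : 0 < r := (norm_nonneg c).trans_lt hcr
  have hrM : r * M < 1 := (lt_div_iff₀ hM0).1 hr1
  -- The k-th term with c replaced by w, multiplied by (abfw;q)_∞ to absorb the denominator
  -- (abfw;q)_k. It is entire in w.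
  set F : ℕ → ℂ → ℂ := fun k w => (∏ i ∈ range k, (w - e * q ^ i))
    * qPochInf (a * b * f * w * q ^ k) q * t k with hF
  set K := Real.exp (‖e‖ / r / (1 - ‖q‖)) * Real.exp (‖a * b * f‖ * r / (1 - ‖q‖))
    * (C₁ * C₂) with hK
  have hbound : ∀ (k : ℕ) (w : ℂ), w ∈ Metric.ball (0 : ℂ) r →
      ‖F k w‖ ≤ K * ((k + 1) * (r * M) ^ k) := by
    intro k w hw'
    have hwr : ‖w‖ ≤ r := by simpa using (Metric.mem_ball.1 hw').le
    calc ‖F k w‖ = ‖∏ i ∈ range k, (w - e * q ^ i)‖ * ‖qPochInf (a * b * f * w * q ^ k) q‖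
          * (‖expansionWeight a b e f q k‖ * ‖askeyWilson k ((z + z⁻¹) / 2) e a b f q‖) := by
          simp only [hF, ht, norm_mul]
      _ ≤ (r ^ k * Real.exp (‖e‖ / r / (1 - ‖q‖))) * Real.exp (‖a * b * f‖ * r / (1 - ‖q‖))
          * (C₁ * (C₂ * ((k + 1) * M ^ k))) := by
          gcongr
          · exact norm_prod_sub_le hq1 hr0 hwr e k
          · refine norm_qPochInf_le hq1 ?_
            rw [norm_mul _ (q ^ k), norm_mul _ w, norm_pow]
            calc _ ≤ ‖a * b * f‖ * ‖w‖ * 1 := by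
                  gcongr
                  exact pow_le_one₀ (norm_nonneg q) hq1.le
              _ ≤ _ := by rw [mul_one]; gcongr
          · exact hw k
          · exact hp k
      _ = _ := by rw [hK, mul_pow]; ring
  have hsumm : Summable fun k : ℕ => K * (((k : ℝ) + 1) * (r * M) ^ k) := by
    refine Summable.mul_left K ?_
    have hn : ‖r * M‖ < 1 := by
      rwa [Real.norm_of_nonneg (by positivity)]
    have h1 := summable_pow_mul_geometric_of_norm_lt_one 1 hn
    have h0 := summable_geometric_of_norm_lt_one hn
    refine (h1.add h0).congr fun k => ?_
    ring
  have hdF : DifferentiableOn ℂ (fun w => ∑' k, F k w) (Metric.ball 0 r) := by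
    refine Complex.differentiableOn_tsum_of_summable_norm hsumm (fun k => ?_) Metric.isOpen_ball hbound
    have := differentiable_qPochInf hq1
    have h2 : Differentiable ℂ fun w => qPochInf (a * b * f * w * q ^ k) q :=
      this.comp (g := fun u => qPochInf u q) (f := fun w => a * b * f * w * q ^ k) (by fun_prop)
    simp only [hF]
    fun_prop
  have hdq : ∀ u : ℂ, Differentiable ℂ fun w => qPochInf (w * u) q := fun u =>
    (differentiable_qPochInf hq1).comp (f := fun w => w * u) (by fun_prop)
  have hdq' : ∀ u : ℂ, Differentiable ℂ fun w => qPochInf (u * w) q := fun u =>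
    (differentiable_qPochInf hq1).comp (f := fun w => u * w) (by fun_prop)
  have hdq'' : ∀ u : ℂ, Differentiable ℂ fun w => qPochInf (w / u) q := fun u =>
    (differentiable_qPochInf hq1).comp (f := fun w => w / u) (by fun_prop)
  have nz : ∀ u : ℂ, (∀ j : ℕ, u * q ^ j ≠ 1) → ∀ n, qPoch u q n ≠ 0 := fun u hu n =>
    qPoch_ne_zero (n := n) (fun j _ => hu j) le_rfl
  -- The cleared identity at w = eq^m, where (e/w;q)_k = (q^{-m};q)_k ends the series at k = m.
  have hpoint : ∀ m : ℕ, qPochInf (a * e) q * qPochInf (b * e) q * qPochInf (e * f) q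
        * (qPochInf (e * q ^ m * z) q * qPochInf (e * q ^ m / z) q) * ∑' k, F k (e * q ^ m)
      = qPochInf (a * (e * q ^ m)) q * qPochInf (b * (e * q ^ m)) q * qPochInf (e * q ^ m * f) q
        * (qPochInf (a * b * e * f) q * qPochInf (e * z) q * qPochInf (e / z) q) := by
    intro m
    have hnz : e * q ^ m ≠ 0 := mul_ne_zero he (pow_ne_zero _ hq)
    have hev : ∀ k, F k (e * q ^ m) = (e * q ^ m) ^ k * qPoch (q ^ (-(m : ℤ))) q k
        * qPochInf (a * b * e * f * q ^ m * q ^ k) q * t k := by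
      intro k
      simp only [hF]
      rw [prod_sub_eq hnz, show e / (e * q ^ m) = q ^ (-(m : ℤ)) by
        rw [zpow_neg, zpow_natCast]; field_simp]
      congr 3
      ring
    have hfin : ∀ k ∉ range (m + 1), F k (e * q ^ m) = 0 := by
      intro k hk
      rw [hev, qPoch_neg_pow_eq_zero hq (by simpa [Nat.lt_succ_iff] using hk)]
      ring
    have hsm : ∀ k, qPoch (a * b * e * f * q ^ m) q k ≠ 0 := nz _ fun j => by
      have := hs (1 + m + j)
      rwa [show a * b * e * f / q * q ^ (1 + m + j) = a * b * e * f * q ^ m * q ^ j by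
        field_simp; ring] at this
    have h := sum_expansionWeight_mul_askeyWilson hq hq1 hz he hae hbe hef hs m
    have hsum : ∑' k, F k (e * q ^ m) = qPochInf (a * b * e * f * q ^ m) q
        * (qPoch (a * b * e * f) q m * (qPoch (e * z) q m * qPoch (e / z) q m)
        / (qPoch (a * e) q m * qPoch (b * e) q m * qPoch (e * f) q m)) := by
      rw [tsum_eq_sum hfin, ← h, mul_sum]
      refine sum_congr rfl fun k _ => ?_
      rw [hev, qPochInf_eq_mul hq1 (a * b * e * f * q ^ m) k, ht]
      have := hsm k
      generalize qPoch (a * b * e * f * q ^ m) q k = B at *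
      field_simp
    rw [hsum, qPochInf_eq_mul hq1 (a * e) m, qPochInf_eq_mul hq1 (b * e) m,
      qPochInf_eq_mul hq1 (e * f) m, qPochInf_eq_mul hq1 (a * b * e * f) m,
      qPochInf_eq_mul hq1 (e * z) m, qPochInf_eq_mul hq1 (e / z) m,
      show e * q ^ m * z = e * z * q ^ m by ring, show e * q ^ m / z = e / z * q ^ m by ring,
      show e * q ^ m * f = e * f * q ^ m by ring, ← mul_assoc a, ← mul_assoc b]
    have n1 := nz _ hae m
    have n2 := nz _ hbe m
    have n3 := nz _ hef m
    generalize qPoch (a * e) q m = A1 at *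
    generalize qPoch (b * e) q m = A2 at *
    generalize qPoch (e * f) q m = A3 at *
    calc _ = (A1 * A1⁻¹) * (A2 * A2⁻¹) * (A3 * A3⁻¹) * (qPochInf (a * e * q ^ m) q
          * qPochInf (b * e * q ^ m) q * qPochInf (e * f * q ^ m) q
          * (qPochInf (e * z * q ^ m) q * qPochInf (e / z * q ^ m) q)
          * (qPochInf (a * b * e * f * q ^ m) q * (qPoch (a * b * e * f) q m
            * (qPoch (e * z) q m * qPoch (e / z) q m)))) := by
          simp only [div_eq_mul_inv, mul_inv]; ring
      _ = _ := by
          rw [mul_inv_cancel₀ n1, mul_inv_cancel₀ n2, mul_inv_cancel₀ n3]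
          ring
  -- The identity theorem needs agreement at points tending to 0 but different from 0; only those
  -- eventually inside the disc matter.
  have hlim : Filter.Tendsto (fun m : ℕ => e * q ^ m) Filter.atTop (nhdsWithin 0 {0}ᶜ) := by
    refine tendsto_nhdsWithin_iff.2 ⟨?_, Filter.Eventually.of_forall fun m =>
      mul_ne_zero he (pow_ne_zero _ hq)⟩
    simpa using (tendsto_pow_atTop_nhds_zero_of_norm_lt_one hq1).const_mul e
  have hident := AnalyticOnNhd.eqOn_of_preconnected_of_frequently_eq (𝕜 := ℂ)
    (U := Metric.ball (0 : ℂ) r) (z₀ := 0)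
    (f := fun w => qPochInf (a * e) q * qPochInf (b * e) q * qPochInf (e * f) q
        * (qPochInf (w * z) q * qPochInf (w / z) q) * ∑' k, F k w)
    (g := fun w => qPochInf (a * w) q * qPochInf (b * w) q * qPochInf (w * f) q
        * (qPochInf (a * b * e * f) q * qPochInf (e * z) q * qPochInf (e / z) q))
    (DifferentiableOn.analyticOnNhd (by
      have h1 := (hdq z).differentiableOn (s := Metric.ball (0 : ℂ) r)
      have h2 := (hdq'' z).differentiableOn (s := Metric.ball (0 : ℂ) r)
      fun_prop) Metric.isOpen_ball)
    (DifferentiableOn.analyticOnNhd (by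
      have h1 := (hdq' a).differentiableOn (s := Metric.ball (0 : ℂ) r)
      have h2 := (hdq' b).differentiableOn (s := Metric.ball (0 : ℂ) r)
      have h3 := (hdq f).differentiableOn (s := Metric.ball (0 : ℂ) r)
      fun_prop) Metric.isOpen_ball)
    (convex_ball 0 r).isPreconnected (Metric.mem_ball_self hr0)
    (hlim.frequently (Filter.Eventually.of_forall hpoint).frequently)
  have hcb : c ∈ Metric.ball (0 : ℂ) r := by simpa using hcr
  have hmain := hident hcb
  have hFs : Summable fun k => F k c := Summable.of_norm_bounded hsumm fun k => hbound k c hcb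
  have i0 := qPochInf_ne_zero hq1 habcf
  have i1 := qPochInf_ne_zero hq1 hae
  have i2 := qPochInf_ne_zero hq1 hbe
  have i3 := qPochInf_ne_zero hq1 hef
  have i4 := qPochInf_ne_zero hq1 (mul_pow_ne_one_of_norm_lt_one hq1 hcz)
  have i5 := qPochInf_ne_zero hq1 (mul_pow_ne_one_of_norm_lt_one hq1 hcz')
  have hval : (qPochInf (a * c) q * qPochInf (b * c) q * qPochInf (c * f) q
        * qPochInf (a * b * e * f) q * qPochInf (e * z) q * qPochInf (e / z) q
        / (qPochInf (a * e) q * qPochInf (b * e) q * qPochInf (e * f) q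
          * qPochInf (a * b * c * f) q * qPochInf (c * z) q * qPochInf (c / z) q))
      = (∑' k, F k c) / qPochInf (a * b * c * f) q := by
    beta_reduce at hmain
    rw [div_eq_div_iff (by simp only [ne_eq, mul_eq_zero, i0, i1, i2, i3, i4, i5, or_self,
      not_false_eq_true]) i0]
    linear_combination -qPochInf (a * b * c * f) q * hmain
  rw [hval]
  have hfun : ∀ k : ℕ, F k c / qPochInf (a * b * c * f) q
      = c ^ k * qPoch (e / c) q k / qPoch (a * b * c * f) q k
        * (expansionWeight a b e f q k * askeyWilson k ((z + z⁻¹) / 2) e a b f q) := by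
    intro k
    have n0 := nz _ habcf k
    have hk := qPochInf_eq_mul hq1 (a * b * c * f) k
    simp only [hF, ht]
    rw [prod_sub_eq hc, show a * b * f * c * q ^ k = a * b * c * f * q ^ k by ring]
    have i0' : qPochInf (a * b * c * f * q ^ k) q ≠ 0 := fun h0 => i0 (by rw [hk, h0, mul_zero])
    rw [hk]
    generalize qPochInf (a * b * c * f * q ^ k) q = B at *
    generalize qPoch (a * b * c * f) q k = A at *
    field_simp
  simpa only [hfun] using hFs.hasSum.div_const (qPochInf (a * b * c * f) q)

/-! ### The connection coefficient and its two _4φ_3 forms. -/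

theorem qPoch_mul_shift_comm (u q : ℂ) (j k : ℕ) :
    qPoch u q j * qPoch (u * q ^ j) q k = qPoch u q k * qPoch (u * q ^ k) q j := by
  rw [← qPoch_add, ← qPoch_add, add_comm]

/-- Reversing the two factorials of length j turns them into (wq^{k-j};q)_j and (wq^{-j};q)_j; what
remains is the two ways of splitting (wq^{-j};q)_{j+k}. It moves a shift by j in the base into
factorials of length j. -/
theorem pow_mul_qPoch_div_pow {q w : ℂ} (hq : q ≠ 0) (hw : w ≠ 0) (j k : ℕ) :
    (q ^ j) ^ k * qPoch (w / q ^ j) q k * qPoch (q ^ (1 - (k : ℤ)) / w) q j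
      = qPoch w q k * qPoch (q / w) q j := by
  have hj : q ^ j ≠ 0 := pow_ne_zero _ hq
  have h1 := qPoch_mul_shift_comm (w / q ^ j) q j k
  have h2 := prod_mul_qPoch_inv hq hw k j
  have h3 := prod_mul_qPoch_inv hq hw 0 j
  rw [show w / q ^ j * q ^ j = w by field_simp] at h1
  rw [show w * q ^ ((k : ℤ) - j) = w / q ^ j * q ^ k by
    rw [zpow_sub₀ hq, zpow_natCast, zpow_natCast]; ring] at h2
  rw [show w * q ^ ((0 : ℤ) - j) = w / q ^ j by
    rw [zpow_sub₀ hq, zpow_natCast, zpow_zero]; ring, sub_zero, zpow_one] at h3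
  have h4 : (∏ i ∈ range j, (-(w * q ^ ((k : ℤ) - 1 - i))))
      = (∏ i ∈ range j, (-(w * q ^ ((0 : ℤ) - 1 - i)))) * (q ^ j) ^ k := by
    rw [← pow_mul, mul_comm j k, pow_mul, ← card_range j, ← prod_const, card_range,
      ← prod_mul_distrib]
    refine prod_congr rfl fun i _ => ?_
    rw [neg_mul, mul_assoc, ← zpow_natCast q k, ← zpow_add₀ hq]
    congr 3
    ring
  have h5 : (∏ i ∈ range j, (-(w * q ^ ((0 : ℤ) - 1 - i)))) ≠ 0 :=
    prod_ne_zero_iff.2 fun i _ => neg_ne_zero.2 (mul_ne_zero hw (zpow_ne_zero _ hq))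
  refine mul_left_cancel₀ h5 ?_
  rw [h4] at h2
  linear_combination qPoch (w / q ^ j) q k * h2 - h1 - qPoch w q k * h3

/-- A terminating `_4φ_3` as a finite sum. -/
theorem basicHyp_four_three_eq_sum {q : ℂ} (hq : q ≠ 0) (n : ℕ) (B C D E F G : ℂ) :
    basicHyp [q ^ (-(n : ℤ)), B, C, D] [E, F, G] q q = ∑ j ∈ range (n + 1),
      qPoch (q ^ (-(n : ℤ))) q j * (qPoch B q j * (qPoch C q j * qPoch D q j))
        / (qPoch q q j * (qPoch E q j * (qPoch F q j * qPoch G q j))) * q ^ j := by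
  have h : ∀ k, qPochs [q ^ (-(n : ℤ)), B, C, D] q k / qPochs (q :: [E, F, G]) q k
      * ((-1) ^ k * q ^ (k.choose 2)) ^ (1 + (([E, F, G] : List ℂ).length : ℤ)
        - (([q ^ (-(n : ℤ)), B, C, D] : List ℂ).length : ℤ)) * q ^ k
      = qPoch (q ^ (-(n : ℤ))) q k * (qPoch B q k * (qPoch C q k * qPoch D q k))
        / (qPoch q q k * (qPoch E q k * (qPoch F q k * qPoch G q k))) * q ^ k := by
    intro k
    simp [qPochs]
  rw [basicHyp, tsum_congr h]
  refine tsum_eq_sum fun k hk => ?_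
  rw [qPoch_neg_pow_eq_zero hq (by simpa [Nat.lt_succ_iff] using hk)]
  ring

/-- The coefficient connecting `p_n(x; a, b, c, d | q)` to the `p_k(x; a, b, e, f | q)`, up to
normalization. -/
noncomputable def connectionCoeff (a b c d e f q : ℂ) (n k : ℕ) : ℂ :=
  ∑ j ∈ range (n + 1), qPoch (q ^ (-(n : ℤ))) q j / qPoch q q j * q ^ j
    * qPoch (q ^ ((n : ℤ) - 1) * (a * b * c * d)) q j * qPoch (c * d * q ^ j) q (n - j)
    * (qPoch (c * f) q j / qPoch (a * b * c * f) q j)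
    * ((c * q ^ j) ^ k * qPoch (e / (c * q ^ j)) q k / qPoch (a * b * c * f * q ^ j) q k)

/-- A termwise identity: (e/(cq^j);q)_k and (abcfq^j;q)_k become their values at j = 0 times
factorials of length j with k-dependent bases. -/
theorem connectionCoeff_eq_basicHyp {a b c d e f q : ℂ} (hq : q ≠ 0) (hc : c ≠ 0) (he : e ≠ 0)
    (n k : ℕ) (habcf : ∀ j : ℕ, a * b * c * f * q ^ j ≠ 1)
    (hcd : ∀ j < n, c * d * q ^ j ≠ 1)
    (hce : ∀ j < n, q ^ (1 - (k : ℤ)) * (c / e) * q ^ j ≠ 1) :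
    connectionCoeff a b c d e f q n k
      = qPoch (c * d) q n * (c ^ k * qPoch (e / c) q k / qPoch (a * b * c * f) q k)
        * basicHyp [q ^ (-(n : ℤ)), q ^ ((n : ℤ) - 1) * (a * b * c * d), c * f, q * c / e]
              [c * d, q ^ k * (a * b * c * f), q ^ (1 - (k : ℤ)) * (c / e)] q q := by
  rw [basicHyp_four_three_eq_sum hq, connectionCoeff, mul_sum]
  refine sum_congr rfl fun j hj => ?_
  have hj' : j ≤ n := Nat.lt_succ_iff.1 (mem_range.1 hj)
  have nz : ∀ i m, qPoch (a * b * c * f * q ^ i) q m ≠ 0 := fun i m =>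
    qPoch_ne_zero (n := m) (fun l _ => by
      have := habcf (i + l)
      rwa [pow_add, ← mul_assoc] at this) le_rfl
  have n0 : ∀ m, qPoch (a * b * c * f) q m ≠ 0 := fun m => by simpa using nz 0 m
  have n1 : qPoch (c * d) q j ≠ 0 := qPoch_ne_zero hcd hj'
  have n2 : qPoch (q ^ (1 - (k : ℤ)) * (c / e)) q j ≠ 0 := qPoch_ne_zero hce hj'
  have h1 := qPoch_mul_shift_comm (a * b * c * f) q j k
  have h2 := pow_mul_qPoch_div_pow hq (div_ne_zero he hc) j k
  rw [show q ^ (1 - (k : ℤ)) / (e / c) = q ^ (1 - (k : ℤ)) * (c / e) by field_simp,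
    show q / (e / c) = q * c / e by field_simp, div_div] at h2
  have e1 : c ^ k * (q ^ j) ^ k * qPoch (e / (c * q ^ j)) q k
      / (qPoch (a * b * c * f) q j * qPoch (a * b * c * f * q ^ j) q k)
      = c ^ k * qPoch (e / c) q k * qPoch (q * c / e) q j / (qPoch (a * b * c * f) q k
        * qPoch (a * b * c * f * q ^ k) q j * qPoch (q ^ (1 - (k : ℤ)) * (c / e)) q j) := by
    rw [h1, div_eq_div_iff (mul_ne_zero (n0 k) (nz k j))
      (mul_ne_zero (mul_ne_zero (n0 k) (nz k j)) n2)]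
    linear_combination (c ^ k * qPoch (a * b * c * f) q k * qPoch (a * b * c * f * q ^ k) q j) * h2
  have e2 : qPoch (c * d * q ^ j) q (n - j) = qPoch (c * d) q n / qPoch (c * d) q j := by
    rw [eq_div_iff n1, qPoch_split (c * d) q hj', mul_comm]
  rw [e2, mul_pow, mul_comm (q ^ k)]
  calc _ = qPoch (q ^ (-(n : ℤ))) q j / qPoch q q j * q ^ j
        * qPoch (q ^ ((n : ℤ) - 1) * (a * b * c * d)) q j
        * (qPoch (c * d) q n / qPoch (c * d) q j) * qPoch (c * f) q j
        * (c ^ k * (q ^ j) ^ k * qPoch (e / (c * q ^ j)) q k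
      / (qPoch (a * b * c * f) q j * qPoch (a * b * c * f * q ^ j) q k)) := by
        simp only [div_eq_mul_inv, mul_inv]; ring
    _ = _ := by
        rw [e1]
        simp only [div_eq_mul_inv, mul_inv]; ring

/-- A _4φ_3 transformation obtained from a double sum: the k-dependent factor is opened as a
balanced sum over i ≤ k, and the sum over j ≤ n is then balanced as well, so the terminating index
passes from n to k. -/
theorem connectionCoeff_eq_basicHyp' {a b c d e f q : ℂ} (hq : q ≠ 0) (hq1 : ‖q‖ < 1)
    (hc : c ≠ 0) (hd : d ≠ 0) (he : e ≠ 0) (hf : f ≠ 0)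
    (n k : ℕ) (habcf : ∀ j : ℕ, a * b * c * f * q ^ j ≠ 1)
    (hef : ∀ j : ℕ, e * f * q ^ j ≠ 1)
    (hfd : ∀ j : ℕ, q ^ (1 - (n : ℤ)) * (f / d) * q ^ j ≠ 1) :
    f ^ k * qPoch (a * b) q k * connectionCoeff a b c d e f q n k
      = qPoch (e * f) q k * qPoch (a * b) q n * (c * f) ^ n * qPoch (d / f) q n
          / qPoch (a * b * c * f) q n
        * basicHyp [q ^ (-(k : ℤ)), q ^ ((k : ℤ) - 1) * (a * b * e * f), c * f, q * f / d]
              [e * f, q ^ n * (a * b * c * f), q ^ (1 - (n : ℤ)) * (f / d)] q q := by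
  have nz : ∀ i m, qPoch (a * b * c * f * q ^ i) q m ≠ 0 := fun i m =>
    qPoch_ne_zero (n := m) (fun l _ => by
      have := habcf (i + l)
      rwa [pow_add, ← mul_assoc] at this) le_rfl
  have n0 : ∀ m, qPoch (a * b * c * f) q m ≠ 0 := fun m => by simpa using nz 0 m
  have n1 : ∀ m, qPoch (e * f) q m ≠ 0 := fun m => qPoch_ne_zero (n := m) (fun l _ => hef l) le_rfl
  have n2 : ∀ m, qPoch (q ^ (1 - (n : ℤ)) * (f / d)) q m ≠ 0 := fun m =>
    qPoch_ne_zero (n := m) (fun l _ => hfd l) le_rfl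
  -- Balanced sum with X = cfq^j, E = ef, F = abcfq^j; here E/X = e/(cq^j) and F/X = ab.
  have expand : ∀ j, f ^ k * qPoch (a * b) q k
      * ((c * q ^ j) ^ k * qPoch (e / (c * q ^ j)) q k / qPoch (a * b * c * f * q ^ j) q k)
      = ∑ i ∈ range (k + 1), qPoch (q ^ (-(k : ℤ))) q i / qPoch q q i * q ^ i
        * qPoch (q ^ ((k : ℤ) - 1) * (a * b * e * f)) q i * (qPoch (e * f) q k / qPoch (e * f) q i)
        * (qPoch (c * f * q ^ j) q i / qPoch (a * b * c * f * q ^ j) q i) := by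
    intro j
    have hj : q ^ j ≠ 0 := pow_ne_zero _ hq
    have h := sum_balanced hq hq1 (X := c * f * q ^ j) (Y := q ^ ((k : ℤ) - 1) * (a * b * e * f))
      (E := e * f) (F := a * b * c * f * q ^ j) (mul_ne_zero (mul_ne_zero hc hf) hj)
      (mul_ne_zero he hf) k (by ring)
    rw [show e * f / (c * f * q ^ j) = e / (c * q ^ j) by field_simp,
      show a * b * c * f * q ^ j / (c * f * q ^ j) = a * b by field_simp] at h
    calc _ = (c * f * q ^ j) ^ k * (qPoch (e / (c * q ^ j)) q k * qPoch (a * b) q k)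
          / qPoch (a * b * c * f * q ^ j) q k := by
          rw [mul_pow, mul_pow, mul_pow]; ring
      _ = _ := by
          rw [← h, sum_div]
          refine sum_congr rfl fun i hi => ?_
          have hi' : i ≤ k := Nat.lt_succ_iff.1 (mem_range.1 hi)
          rw [qPoch_split (e * f) q hi', qPoch_split (a * b * c * f * q ^ j) q hi']
          have m1 := n1 i
          have m2 := nz j i
          have m3 : qPoch (a * b * c * f * q ^ j * q ^ i) q (k - i) ≠ 0 := by
            rw [mul_assoc, ← pow_add]; exact nz _ _
          generalize qPoch (a * b * c * f * q ^ j * q ^ i) q (k - i) = x1 at *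
          generalize qPoch (a * b * c * f * q ^ j) q i = x2 at *
          generalize qPoch (e * f) q i = x3 at *
          field_simp
  -- Balanced sum with X = cfq^i, E = cd, F = abcfq^i. It leaves (dq^{-i}/f;q)_n, whose shift by i
  -- is then moved into factorials of length i.
  have inner : ∀ i, ∑ j ∈ range (n + 1), qPoch (q ^ (-(n : ℤ))) q j / qPoch q q j * q ^ j
        * (qPoch (c * f * q ^ i) q j * qPoch (q ^ ((n : ℤ) - 1) * (a * b * c * d)) q j)
        * (qPoch (c * d * q ^ j) q (n - j) / qPoch (a * b * c * f * q ^ i) q j)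
      = qPoch (a * b) q n * (c * f) ^ n * qPoch (d / f) q n / qPoch (a * b * c * f) q n
        * (qPoch (q * f / d) q i * qPoch (a * b * c * f) q i
          / (qPoch (a * b * c * f * q ^ n) q i * qPoch (q ^ (1 - (n : ℤ)) * (f / d)) q i)) := by
    intro i
    have hi : q ^ i ≠ 0 := pow_ne_zero _ hq
    have h := sum_balanced hq hq1 (X := c * f * q ^ i) (Y := q ^ ((n : ℤ) - 1) * (a * b * c * d))
      (E := c * d) (F := a * b * c * f * q ^ i) (mul_ne_zero (mul_ne_zero hc hf) hi)
      (mul_ne_zero hc hd) n (by ring)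
    rw [show c * d / (c * f * q ^ i) = d / f / q ^ i by field_simp,
      show a * b * c * f * q ^ i / (c * f * q ^ i) = a * b by field_simp] at h
    have h2 := pow_mul_qPoch_div_pow hq (div_ne_zero hd hf) i n
    rw [show q ^ (1 - (n : ℤ)) / (d / f) = q ^ (1 - (n : ℤ)) * (f / d) by field_simp,
      show q / (d / f) = q * f / d by field_simp] at h2
    have h3 := qPoch_mul_shift_comm (a * b * c * f) q i n
    calc _ = ((c * f * q ^ i) ^ n * (qPoch (d / f / q ^ i) q n * qPoch (a * b) q n))
          / qPoch (a * b * c * f * q ^ i) q n := by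
          rw [← h, sum_div]
          refine sum_congr rfl fun j hj => ?_
          have hj' : j ≤ n := Nat.lt_succ_iff.1 (mem_range.1 hj)
          rw [qPoch_split (a * b * c * f * q ^ i) q hj']
          have m2 := nz i j
          have m3 : qPoch (a * b * c * f * q ^ i * q ^ j) q (n - j) ≠ 0 := by
            rw [mul_assoc, ← pow_add]; exact nz _ _
          generalize qPoch (a * b * c * f * q ^ i * q ^ j) q (n - j) = x1 at *
          generalize qPoch (a * b * c * f * q ^ i) q j = x2 at *
          field_simp
      _ = _ := by
          rw [div_mul_div_comm, div_eq_div_iff (nz i n)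
            (mul_ne_zero (n0 n) (mul_ne_zero (nz n i) (n2 i))), mul_pow (c * f)]
          linear_combination ((c * f) ^ n * qPoch (a * b) q n * qPoch (a * b * c * f) q n
              * qPoch (a * b * c * f * q ^ n) q i) * h2
            - ((c * f) ^ n * qPoch (a * b) q n * qPoch (d / f) q n * qPoch (q * f / d) q i) * h3
  calc _ = ∑ j ∈ range (n + 1), ∑ i ∈ range (k + 1),
        (qPoch (q ^ (-(k : ℤ))) q i / qPoch q q i * q ^ i
          * qPoch (q ^ ((k : ℤ) - 1) * (a * b * e * f)) q i
          * (qPoch (e * f) q k / qPoch (e * f) q i)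
          * (qPoch (c * f) q i / qPoch (a * b * c * f) q i))
        * (qPoch (q ^ (-(n : ℤ))) q j / qPoch q q j * q ^ j
        * (qPoch (c * f * q ^ i) q j * qPoch (q ^ ((n : ℤ) - 1) * (a * b * c * d)) q j)
        * (qPoch (c * d * q ^ j) q (n - j) / qPoch (a * b * c * f * q ^ i) q j)) := by
        rw [connectionCoeff, mul_sum]
        refine sum_congr rfl fun j _ => ?_
        calc _ = qPoch (q ^ (-(n : ℤ))) q j / qPoch q q j * q ^ j
              * qPoch (q ^ ((n : ℤ) - 1) * (a * b * c * d)) q j * qPoch (c * d * q ^ j) q (n - j)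
              * (qPoch (c * f) q j / qPoch (a * b * c * f) q j)
              * (f ^ k * qPoch (a * b) q k * ((c * q ^ j) ^ k * qPoch (e / (c * q ^ j)) q k
                / qPoch (a * b * c * f * q ^ j) q k)) := by ring
          _ = _ := by
              rw [expand, mul_sum]
              refine sum_congr rfl fun i _ => ?_
              have h4 : qPoch (c * f) q j / qPoch (a * b * c * f) q j
                  * (qPoch (c * f * q ^ j) q i / qPoch (a * b * c * f * q ^ j) q i)
                  = qPoch (c * f) q i / qPoch (a * b * c * f) q i
                  * (qPoch (c * f * q ^ i) q j / qPoch (a * b * c * f * q ^ i) q j) := by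
                rw [div_mul_div_comm, div_mul_div_comm, qPoch_mul_shift_comm (c * f),
                  qPoch_mul_shift_comm (a * b * c * f)]
              linear_combination (qPoch (q ^ (-(n : ℤ))) q j / qPoch q q j * q ^ j
                * qPoch (q ^ ((n : ℤ) - 1) * (a * b * c * d)) q j * qPoch (c * d * q ^ j) q (n - j)
                * (qPoch (q ^ (-(k : ℤ))) q i / qPoch q q i * q ^ i
                * qPoch (q ^ ((k : ℤ) - 1) * (a * b * e * f)) q i
                * (qPoch (e * f) q k / qPoch (e * f) q i))) * h4
    _ = _ := by
        rw [sum_comm, basicHyp_four_three_eq_sum hq, mul_sum]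
        refine sum_congr rfl fun i _ => ?_
        rw [← mul_sum, inner, mul_comm (q ^ n)]
        have m0 := n0 i
        generalize qPoch (a * b * c * f) q i = x at *
        calc _ = (x * x⁻¹) * (qPoch (q ^ (-(k : ℤ))) q i / qPoch q q i * q ^ i
              * qPoch (q ^ ((k : ℤ) - 1) * (a * b * e * f)) q i
              * (qPoch (e * f) q k / qPoch (e * f) q i) * qPoch (c * f) q i
              * (qPoch (a * b) q n * (c * f) ^ n * qPoch (d / f) q n / qPoch (a * b * c * f) q n)
              * (qPoch (q * f / d) q i / (qPoch (a * b * c * f * q ^ n) q i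
                * qPoch (q ^ (1 - (n : ℤ)) * (f / d)) q i))) := by
              simp only [div_eq_mul_inv, mul_inv]; ring
          _ = _ := by
              rw [mul_inv_cancel₀ m0]
              simp only [div_eq_mul_inv, mul_inv]; ring

/-! ### Assembling the expansions. -/

/-- The expansion of `p_n(x; a, b, c, d | q)` in the `p_k(x; a, b, e, f | q)`, with the
coefficients in unreduced form. -/
theorem hasSum_connectionCoeff {q z a b c d e f : ℂ} (n : ℕ) (hq : q ≠ 0) (hq1 : ‖q‖ < 1)
    (hz : z ≠ 0) (ha : a ≠ 0) (hb : b ≠ 0) (hc : c ≠ 0) (hd : d ≠ 0) (he : e ≠ 0) (hf : f ≠ 0)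
    (hcz : ‖c * z‖ < 1) (hcz' : ‖c / z‖ < 1)
    (hac : ∀ j : ℕ, a * c * q ^ j ≠ 1) (hbc : ∀ j : ℕ, b * c * q ^ j ≠ 1)
    (hcf : ∀ j : ℕ, c * f * q ^ j ≠ 1)
    (hae : ∀ j : ℕ, a * e * q ^ j ≠ 1) (hbe : ∀ j : ℕ, b * e * q ^ j ≠ 1)
    (hef : ∀ j : ℕ, e * f * q ^ j ≠ 1) (habcf : ∀ j : ℕ, a * b * c * f * q ^ j ≠ 1)
    (hs : ∀ j : ℕ, a * b * e * f / q * q ^ j ≠ 1)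
    (hez : ∀ j : ℕ, e * z * q ^ j ≠ 1) (hez' : ∀ j : ℕ, e / z * q ^ j ≠ 1) :
    ∃ S : ℂ, HasSum (fun k : ℕ => (c ^ n)⁻¹ * (expansionWeight a b e f q k
        * askeyWilson k ((z + z⁻¹) / 2) a b e f q * connectionCoeff a b c d e f q n k)) S ∧
      askeyWilson n ((z + z⁻¹) / 2) a b c d q =
          qPochsInf [a * e, b * e, e * f, a * b * c * f, c * z, c / z] q
            / qPochsInf [a * c, b * c, c * f, a * b * e * f, e * z, e / z] q
          * (qPoch (a * c) q n * qPoch (b * c) q n) * S := by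
  have shift : ∀ {u : ℂ}, (∀ j : ℕ, u * q ^ j ≠ 1) → ∀ i j : ℕ, u * q ^ i * q ^ j ≠ 1 := by
    intro u hu i j
    have := hu (i + j)
    rwa [pow_add, ← mul_assoc] at this
  have hs' : ∀ j : ℕ, a * b * e * f * q ^ j ≠ 1 := fun j => by
    have := shift hs 1 j
    rwa [pow_one, div_mul_cancel₀ _ hq] at this
  have small : ∀ {u : ℂ}, ‖u‖ < 1 → ∀ j : ℕ, ‖u * q ^ j‖ < 1 := by
    intro u hu j
    rw [norm_mul, norm_pow]
    exact mul_lt_one_of_nonneg_of_lt_one_left (norm_nonneg u) hu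
      (pow_le_one₀ (norm_nonneg q) hq1.le)
  -- The quotient expansion at cq^j; smallness and nonvanishing pass from c to cq^j.
  have base := fun j : ℕ => hasSum_expansionWeight_mul_askeyWilson (c := c * q ^ j) hq hq1 hz ha hb
    (mul_ne_zero hc (pow_ne_zero j hq)) he hf
    (by rw [mul_right_comm]; exact small hcz j) (by rw [mul_div_right_comm]; exact small hcz' j)
    hae hbe hef hs (fun i => by
      rw [show a * b * (c * q ^ j) * f = a * b * c * f * q ^ j by ring]; exact shift habcf j i)
  have hsum := hasSum_sum (s := range (n + 1)) fun j _ => (base j).mul_left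
    ((c ^ n)⁻¹ * (qPoch (q ^ (-(n : ℤ))) q j / qPoch q q j * q ^ j
    * qPoch (q ^ ((n : ℤ) - 1) * (a * b * c * d)) q j * qPoch (c * d * q ^ j) q (n - j)
    * (qPoch (c * f) q j / qPoch (a * b * c * f) q j)))
  have congr_terms : ∀ {g h : ℕ → ℂ} {s : ℂ}, HasSum g s → (∀ k, h k = g k) → HasSum h s :=
    fun hg hh => by rwa [funext hh]
  refine ⟨_, congr_terms hsum fun k => ?_, ?_⟩
  · rw [connectionCoeff, mul_sum, mul_sum, askeyWilson_rotate k hq hq1 hz ha hb he hf]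
    refine sum_congr rfl fun j _ => ?_
    rw [show a * b * (c * q ^ j) * f = a * b * c * f * q ^ j by ring]
    ring
  · rw [askeyWilson_rotate n hq hq1 hz ha hb hc hd, askeyWilson_eq_sum n c a b d q hz, mul_sum,
      mul_sum]
    refine sum_congr rfl fun j hj => ?_
    have hj' : j ≤ n := Nat.lt_succ_iff.1 (mem_range.1 hj)
    have nz : ∀ {u : ℂ}, (∀ j : ℕ, u * q ^ j ≠ 1) → ∀ m, qPoch u q m ≠ 0 := fun hu m =>
      qPoch_ne_zero (n := m) (fun i _ => hu i) le_rfl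
    -- The x-dependent part of the j-th term of p_n, based at c, is the common prefactor times the
    -- value of the quotient expansion at cq^j.
    have key : qPoch (c * z) q j * qPoch (c / z) q j * (qPoch (c * a * q ^ j) q (n - j)
        * qPoch (c * b * q ^ j) q (n - j))
        = qPochsInf [a * e, b * e, e * f, a * b * c * f, c * z, c / z] q
            / qPochsInf [a * c, b * c, c * f, a * b * e * f, e * z, e / z] q
          * (qPoch (a * c) q n * qPoch (b * c) q n)
          * (qPoch (c * f) q j / qPoch (a * b * c * f) q j
          * (qPochInf (a * (c * q ^ j)) q * qPochInf (b * (c * q ^ j)) q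
            * qPochInf (c * q ^ j * f) q * qPochInf (a * b * e * f) q
            * qPochInf (e * z) q * qPochInf (e / z) q
            / (qPochInf (a * e) q * qPochInf (b * e) q * qPochInf (e * f) q
            * qPochInf (a * b * (c * q ^ j) * f) q * qPochInf (c * q ^ j * z) q
            * qPochInf (c * q ^ j / z) q))) := by
      simp only [qPochsInf, List.map_cons, List.map_nil, List.prod_cons, List.prod_nil, mul_one]
      rw [qPochInf_eq_mul hq1 (a * c) j, qPochInf_eq_mul hq1 (b * c) j,
        qPochInf_eq_mul hq1 (c * f) j, qPochInf_eq_mul hq1 (a * b * c * f) j,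
        qPochInf_eq_mul hq1 (c * z) j, qPochInf_eq_mul hq1 (c / z) j,
        qPoch_split (a * c) q hj', qPoch_split (b * c) q hj',
        show a * b * (c * q ^ j) * f = a * b * c * f * q ^ j by ring,
        show c * q ^ j * f = c * f * q ^ j by ring, show c * q ^ j * z = c * z * q ^ j by ring,
        show c * q ^ j / z = c / z * q ^ j by ring, ← mul_assoc a c, ← mul_assoc b c,
        mul_comm c a, mul_comm c b]
      have n1 := nz hac j
      have n2 := nz hbc j
      have n3 := nz hcf j
      have n4 := nz habcf j
      have i1 := qPochInf_ne_zero hq1 (shift hac j)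
      have i2 := qPochInf_ne_zero hq1 (shift hbc j)
      have i3 := qPochInf_ne_zero hq1 (shift hcf j)
      have i4 := qPochInf_ne_zero hq1 (shift habcf j)
      have i5 := qPochInf_ne_zero hq1 (mul_pow_ne_one_of_norm_lt_one hq1 (small hcz j))
      have i6 := qPochInf_ne_zero hq1 (mul_pow_ne_one_of_norm_lt_one hq1 (small hcz' j))
      have k1 := qPochInf_ne_zero hq1 hae
      have k2 := qPochInf_ne_zero hq1 hbe
      have k3 := qPochInf_ne_zero hq1 hef
      have k4 := qPochInf_ne_zero hq1 hs'
      have k5 := qPochInf_ne_zero hq1 hez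
      have k6 := qPochInf_ne_zero hq1 hez'
      generalize qPoch (a * c) q j = A1 at *
      generalize qPoch (b * c) q j = A2 at *
      generalize qPoch (c * f) q j = A3 at *
      generalize qPoch (a * b * c * f) q j = A4 at *
      generalize qPoch (c * z) q j = A5 at *
      generalize qPoch (c / z) q j = A6 at *
      generalize qPochInf (a * c * q ^ j) q = B1 at *
      generalize qPochInf (b * c * q ^ j) q = B2 at *
      generalize qPochInf (c * f * q ^ j) q = B3 at *
      generalize qPochInf (a * b * c * f * q ^ j) q = B4 at *
      generalize qPochInf (c * z * q ^ j) q = B5 at *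
      generalize qPochInf (c / z * q ^ j) q = B6 at *
      generalize qPochInf (a * e) q = C1 at *
      generalize qPochInf (b * e) q = C2 at *
      generalize qPochInf (e * f) q = C3 at *
      generalize qPochInf (a * b * e * f) q = C4 at *
      generalize qPochInf (e * z) q = C5 at *
      generalize qPochInf (e / z) q = C6 at *
      generalize qPoch (a * c * q ^ j) q (n - j) = R1 at *
      generalize qPoch (b * c * q ^ j) q (n - j) = R2 at *
      field_simp
    rw [show c * a * b * d = a * b * c * d by ring]
    linear_combination ((c ^ n)⁻¹ * (qPoch (q ^ (-(n : ℤ))) q j / qPoch q q j * q ^ j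
      * qPoch (q ^ ((n : ℤ) - 1) * (a * b * c * d)) q j * qPoch (c * d * q ^ j) q (n - j))) * key

theorem theorem6p1 (n : ℕ) (q z a b c d e f : ℂ)
    (hq0 : q ≠ 0) (hq1 : ‖q‖ < 1)
    (hz : z ≠ 0) (ha : a ≠ 0) (hb : b ≠ 0) (hc : c ≠ 0) (hd : d ≠ 0) (he : e ≠ 0) (hf : f ≠ 0)
    (hcz : max ‖c * z‖ ‖c / z‖ < 1)
    -- the denominators common to both expansions do not vanish
    (hden : ∀ w ∈ [a * c, b * c, c * f, a * e, b * e, e * f, a * b * c * f, a * b * e * f / q,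
      e * z, e / z], ∀ j : ℕ, w * q ^ j ≠ 1) :
    -- first expansion, whenever the remaining denominators of its `_4φ_3` do not vanish
    ((∀ j < n, c * d * q ^ j ≠ 1) →
      (∀ k : ℕ, ∀ j < n, q ^ (1 - (k : ℤ)) * (c / e) * q ^ j ≠ 1) →
      ∃ S : ℂ,
        HasSum (fun k : ℕ => c ^ ((k : ℤ) - n)
          * (qPoch (a * b * e * f) q (2 * k) * qPochs [e / c, a * b * e * f / q] q k
            / (qPoch (a * b * e * f / q) q (2 * k)
              * qPochs [q, a * e, b * e, e * f, a * b * c * f] q k))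
          * askeyWilson k ((z + z⁻¹) / 2) a b e f q
          * basicHyp [q ^ (-(n : ℤ)), q ^ ((n : ℤ) - 1) * (a * b * c * d), c * f, q * c / e]
              [c * d, q ^ k * (a * b * c * f), q ^ (1 - (k : ℤ)) * (c / e)] q q) S ∧
        askeyWilson n ((z + z⁻¹) / 2) a b c d q =
          qPochsInf [a * e, b * e, e * f, a * b * c * f, c * z, c / z] q
            / qPochsInf [a * c, b * c, c * f, a * b * e * f, e * z, e / z] q
          * qPochs [a * c, b * c, c * d] q n * S) ∧
    -- second expansion, whenever its remaining denominators do not vanish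
    ((∀ j : ℕ, a * b * q ^ j ≠ 1) →
      (∀ j : ℕ, q ^ (1 - (n : ℤ)) * (f / d) * q ^ j ≠ 1) →
      ∃ S : ℂ,
        HasSum (fun k : ℕ => f ^ ((n : ℤ) - k)
          * (qPoch (a * b * e * f) q (2 * k) * qPoch (a * b * e * f / q) q k
            / (qPoch (a * b * e * f / q) q (2 * k) * qPochs [q, a * b, a * e, b * e] q k))
          * askeyWilson k ((z + z⁻¹) / 2) a b e f q
          * basicHyp [q ^ (-(k : ℤ)), q ^ ((k : ℤ) - 1) * (a * b * e * f), c * f, q * f / d]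
              [e * f, q ^ n * (a * b * c * f), q ^ (1 - (n : ℤ)) * (f / d)] q q) S ∧
        askeyWilson n ((z + z⁻¹) / 2) a b c d q =
          qPochsInf [a * e, b * e, e * f, a * b * c * f, c * z, c / z] q
            / qPochsInf [a * c, b * c, c * f, a * b * e * f, e * z, e / z] q
          * (qPochs [a * b, a * c, b * c, d / f] q n / qPoch (a * b * c * f) q n) * S) := by
  simp only [List.forall_mem_cons, List.not_mem_nil, false_imp_iff, implies_true, and_true] at hden
  obtain ⟨hac, hbc, hcf, hae, hbe, hef, habcf, hs, hez, hez'⟩ := hden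
  obtain ⟨hcz, hcz'⟩ := max_lt_iff.1 hcz
  obtain ⟨S, hS, hp⟩ := hasSum_connectionCoeff n hq0 hq1 hz ha hb hc hd he hf hcz hcz' hac hbc hcf
    hae hbe hef habcf hs hez hez'
  refine ⟨fun hcd hce => ?_, fun hab hfd => ?_⟩
  · have n1 : qPoch (c * d) q n ≠ 0 := qPoch_ne_zero hcd le_rfl
    refine ⟨S / qPoch (c * d) q n, ?_, ?_⟩
    · convert! hS.div_const (qPoch (c * d) q n) using 1
      funext k
      rw [connectionCoeff_eq_basicHyp hq0 hc he n k habcf hcd (hce k), zpow_sub₀ hc, zpow_natCast,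
        zpow_natCast, expansionWeight]
      simp only [qPochs, List.map_cons, List.map_nil, List.prod_cons, List.prod_nil, mul_one]
      generalize basicHyp _ _ _ _ = Φ
      generalize qPoch (c * d) q n = x at *
      symm
      rw [div_eq_iff n1]
      simp only [div_eq_mul_inv, mul_inv]
      ring
    · rw [hp]
      simp only [qPochs, List.map_cons, List.map_nil, List.prod_cons, List.prod_nil, mul_one]
      generalize qPochsInf _ _ / qPochsInf _ _ = P
      field_simp
  · have n1 : ∀ k, qPoch (a * b) q k ≠ 0 := fun k => qPoch_ne_zero (n := k) (fun j _ => hab j) le_rfl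
    have n2 : ∀ k, qPoch (e * f) q k ≠ 0 := fun k => qPoch_ne_zero (n := k) (fun j _ => hef j) le_rfl
    have n3 : qPoch (a * b * c * f) q n ≠ 0 := qPoch_ne_zero (n := n) (fun j _ => habcf j) le_rfl
    -- If (d/f)q^j = 1 for some j < n, then q^{1-n}f/d = q^{-(n-1-j)}, an excluded value. The series
    -- can thus be divided by (d/f;q)_n.
    have n4 : qPoch (d / f) q n ≠ 0 := by
      refine qPoch_ne_zero (n := n) (fun j hj h => ?_) le_rfl
      apply hfd (n - 1 - j)
      have e1 : q ^ (1 - (n : ℤ)) * (q ^ (n - 1 - j) * q ^ j) = 1 := by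
        rw [← pow_add, ← zpow_natCast q, ← zpow_add₀ hq0,
          show 1 - (n : ℤ) + ((n - 1 - j + j : ℕ) : ℤ) = 0 by omega, zpow_zero]
      have e2 : f / d = q ^ j := by
        have : f = d * q ^ j := by
          field_simp at h
          linear_combination -h
        rw [div_eq_iff hd]
        linear_combination this
      rw [e2]
      linear_combination e1
    have hκ : qPoch (a * b) q n * qPoch (d / f) q n / qPoch (a * b * c * f) q n ≠ 0 :=
      div_ne_zero (mul_ne_zero (n1 n) n4) n3
    refine ⟨S / (qPoch (a * b) q n * qPoch (d / f) q n / qPoch (a * b * c * f) q n), ?_, ?_⟩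
    · convert! hS.div_const (qPoch (a * b) q n * qPoch (d / f) q n
        / qPoch (a * b * c * f) q n) using 1
      funext k
      have h := connectionCoeff_eq_basicHyp' hq0 hq1 hc hd he hf n k habcf hef hfd
      have hfk : f ^ k * qPoch (a * b) q k ≠ 0 := mul_ne_zero (pow_ne_zero _ hf) (n1 k)
      have h' := eq_div_of_mul_eq hfk ((mul_comm _ _).trans h)
      rw [eq_div_iff hκ, h', zpow_sub₀ hf, zpow_natCast, zpow_natCast, expansionWeight]
      simp only [qPochs, List.map_cons, List.map_nil, List.prod_cons, List.prod_nil, mul_one]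
      generalize basicHyp _ _ _ _ = Φ
      have m1 : qPoch (e * f) q k * (qPoch (e * f) q k)⁻¹ = 1 := mul_inv_cancel₀ (n2 k)
      have m2 : (c ^ n)⁻¹ * c ^ n = 1 := inv_mul_cancel₀ (pow_ne_zero _ hc)
      rw [mul_pow]
      symm
      calc _ = (qPoch (e * f) q k * (qPoch (e * f) q k)⁻¹) * ((c ^ n)⁻¹ * c ^ n)
            * (f ^ n / f ^ k * (qPoch (a * b * e * f) q (2 * k) * qPoch (a * b * e * f / q) q k
            / (qPoch (a * b * e * f / q) q (2 * k) * (qPoch q q k * (qPoch (a * b) q k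
              * (qPoch (a * e) q k * qPoch (b * e) q k)))))
            * askeyWilson k ((z + z⁻¹) / 2) a b e f q * Φ
            * (qPoch (a * b) q n * qPoch (d / f) q n / qPoch (a * b * c * f) q n)) := by
            simp only [div_eq_mul_inv, mul_inv]; ring
        _ = _ := by rw [m1, m2, one_mul, one_mul]
    · rw [hp]
      simp only [qPochs, List.map_cons, List.map_nil, List.prod_cons, List.prod_nil, mul_one]
      generalize qPochsInf _ _ / qPochsInf _ _ = P
      have := n1 n
      generalize qPoch (a * b) q n = x at *
      generalize qPoch (d / f) q n = y at *
      generalize qPoch (a * b * c * f) q n = w at *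
      field_simp
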